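/- Let $H=-\frac{d^2}{dx^2}+|x|$ be the self-adjoint operator on $L^2(\mathbb R)$ with domain $\{u\in L^2(\mathbb R): -u''+|x|u\in L^2(\mathbb R)\}$, the derivative being taken in the sense of distributions. Its eigenvalues form an infinite strictly increasing sequence $\lambda_1<\lambda_2<\cdots$. For each $k\ge 1$ let $\varphi_k$ be an eigenfunction of $H$ for $\lambda_k$ with $\|\varphi_k\|_{L^2(\mathbb R)}=1$. Let $E\subset\mathbb R$ be a Lebesgue measurable set, and write $|\cdot|$ for Lebesgue measure. Then the following statements are equivalent: (i) $E$ is weakly thick, that is, $\displaystyle\liminf_{x\to+\infty}\frac{|E\cap[-x,x]|}{x}>0$. (ii) There is a constant $D_1>0$, independent of $k$, such that $\displaystyle\int_E|\varphi_k(x)|^2\,dx\ge D_1$ for all $k\ge 1$. -/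

import Mathlib

open MeasureTheory Filter
open scoped ContDiff

namespace AnharmonicOscillator

/-- The set `E ⊆ ℝ` is weakly thick: `liminf_{x → +∞} |E ∩ [-x, x]| / x > 0`. The quotient is taken
in `[0, ∞]`, so that the lower limit always exists. -/
def WeaklyThick (E : Set ℝ) : Prop :=
  0 < liminf (fun x : ℝ => volume (E ∩ Set.Icc (-x) x) / ENNReal.ofReal x) atTop

/-- The graph of the operator `H = -d²/dx² + |x|` on `L²(ℝ)` (complex-valued functions):
`HasImage u f` says that `u` lies in the domain of `H` and that `H u = f`.
The domain consists of all `u ∈ L²(ℝ)` for which `-u'' + |x| u`, taken in the sense of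
distributions, belongs to `L²(ℝ)`. As `|x|` is nonnegative and locally square integrable, this is
the unique self-adjoint realization of `-d²/dx² + |x|` on `C_c^∞(ℝ)`. -/
def HasImage (u f : ℝ → ℂ) : Prop :=
  MemLp u 2 volume ∧ MemLp f 2 volume ∧
    ∀ ψ : ℝ → ℝ, ContDiff ℝ ∞ ψ → HasCompactSupport ψ →
      ∫ x, (-(deriv (deriv ψ) x) + |x| * ψ x) • u x = ∫ x, ψ x • f x

/-- `u` is an eigenfunction of `H` for `lam`: `H u = lam u` and `u` is nonzero in `L²(ℝ)`. -/
def IsEigenfunction (lam : ℝ) (u : ℝ → ℂ) : Prop :=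
  HasImage u (fun x => (lam : ℂ) * u x) ∧ ¬ u =ᵐ[volume] 0

/-- `lam` is an eigenvalue of `H` (which, `H` being self-adjoint, has only real ones). -/
def IsEigenvalue (lam : ℝ) : Prop :=
  ∃ u : ℝ → ℂ, IsEigenfunction lam u

/-- `lam 0 < lam 1 < ⋯` is the increasing enumeration of all the eigenvalues of `H`, and each
`φ k` is an `L²`-normalized eigenfunction for `lam k`. (Indices start at `0` here.) -/
structure IsEigensystem (lam : ℕ → ℝ) (φ : ℕ → ℝ → ℂ) : Prop where
  strictMono : StrictMono lam
  range_eq : Set.range lam = {μ : ℝ | IsEigenvalue μ}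
  eigenfunction : ∀ k, IsEigenfunction (lam k) (φ k)
  normalized : ∀ k, ∫ x, ‖φ k x‖ ^ 2 = 1

end AnharmonicOscillator

/-! Everything is read off from one function: the solution a = `airy` of y'' = t y that decays at
+∞, with reflection b = `osc`, b(s) = a(-s), solving b'' = -s b. A weak eigenfunction is a classical
solution of u'' = (|x| - l) u. Square integrability at both ends forces it to be an even or odd
extension of a multiple of a(x - l), so l is an eigenvalue exactly when b or b' vanishes at l. In
either parity a normalized eigenfunction has |φ|² = a(|x| - l)² / (2 M(l)) almost everywhere, where
M(s) = s b(s)² + b'(s)² (`airyMass`) is the integral of a² over (-s, ∞). Both implications are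
therefore statements about this `density` for large l.

Write s b² = M sin²θ and b'² = M cos²θ. Since M' = b², M increases and M(s)/s decreases.

Thickness gives the lower bound: the density at distance s = l - |x| inside the turning point is at
least sin²θ(s) / (2l), so it suffices that sin²θ is small only on a set of small proportion. This
follows from bounding the integrals of cos²ⁿθ by a Wallis recursion (`integral_phaseCos_pow_le`):
their means over [1, t] are at most 1/√(n+1) up to a bounded contribution to the integral, and
Markov's inequality concludes.

The lower bound gives thickness: the layer |x| > l - s carries mass M(s)/M(l), and
`airyMass_growth`, which says that M(s)²/s is increasing up to a constant factor, makes this at most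
a multiple of √η for s = ηl. In the rest of the allowed region the density is O(1/l) for fixed η, so
a set of mass at least D must occupy a fixed fraction of [-l, l].

Eigenvalues occur in every interval of length 4 in [1, ∞), which passes from the energies to all
large x; the finitely many low energies are handled by strict positivity, since each density has
only countably many zeros. -/

namespace AnharmonicOscillator

/-! ### Entire power series and Airy's equation -/

/-- The coefficients decay faster than every geometric sequence. -/
def RapidDecay (a : ℕ → ℝ) : Prop :=
  ∀ r : ℝ, 0 < r → ∃ C : ℝ, ∀ n, |a n| * r ^ n ≤ C

/-- The coefficients of the derivative of a power series. -/
def derivCoeff (a : ℕ → ℝ) (n : ℕ) : ℝ := (n + 1) * a (n + 1)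

/-- The sum of a power series. -/
noncomputable def powerSum (a : ℕ → ℝ) (t : ℝ) : ℝ := ∑' n, a n * t ^ n

theorem RapidDecay.summable {a : ℕ → ℝ} (ha : RapidDecay a) (r : ℝ) (hr : 0 ≤ r) :
    Summable fun n => |a n| * r ^ n := by
  -- The factor 2 leaves room for a convergent geometric series; the shift by 1 keeps the radius
  -- positive when r = 0.
  obtain ⟨C, hC⟩ := ha (2 * (r + 1)) (by positivity)
  refine Summable.of_nonneg_of_le (fun n => by positivity) (fun n => ?_)
    (summable_geometric_two.mul_left C)
  calc |a n| * r ^ n ≤ |a n| * (r + 1) ^ n := by gcongr; linarith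
    _ = (|a n| * (2 * (r + 1)) ^ n) * (1 / 2) ^ n := by
        rw [mul_pow, mul_assoc, mul_right_comm, ← mul_pow]; norm_num
    _ ≤ C * (1 / 2) ^ n := by gcongr; exact hC n

theorem RapidDecay.summable_powerSum {a : ℕ → ℝ} (ha : RapidDecay a) (t : ℝ) :
    Summable fun n => a n * t ^ n := by
  refine Summable.of_norm ((ha.summable |t| (abs_nonneg t)).congr fun n => ?_)
  rw [norm_mul, norm_pow, Real.norm_eq_abs, Real.norm_eq_abs]

theorem RapidDecay.derivCoeff {a : ℕ → ℝ} (ha : RapidDecay a) : RapidDecay (derivCoeff a) := by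
  intro r hr
  obtain ⟨C, hC⟩ := ha (2 * r) (by positivity)
  refine ⟨C / r, fun n => ?_⟩
  rw [le_div_iff₀ hr]
  refine le_trans ?_ (hC (n + 1))
  have h1 : ((n : ℝ) + 1) ≤ 2 ^ (n + 1) := by
    exact_mod_cast (Nat.lt_two_pow_self (n := n + 1)).le
  rw [AnharmonicOscillator.derivCoeff, abs_mul, abs_of_nonneg (by positivity), mul_pow]
  calc (n + 1) * |a (n + 1)| * r ^ n * r = (n + 1) * (|a (n + 1)| * r ^ (n + 1)) := by ring
    _ ≤ 2 ^ (n + 1) * (|a (n + 1)| * r ^ (n + 1)) := by gcongr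
    _ = _ := by ring

theorem RapidDecay.hasDerivAt {a : ℕ → ℝ} (ha : RapidDecay a) (t : ℝ) :
    HasDerivAt (powerSum a) (powerSum (AnharmonicOscillator.derivCoeff a) t) t := by
  have hu : Summable fun n : ℕ => |a n| * (n * (|t| + 1) ^ (n - 1)) := by
    rw [← summable_nat_add_iff 1]
    refine (ha.derivCoeff.summable (|t| + 1) (by positivity)).congr fun n => ?_
    rw [AnharmonicOscillator.derivCoeff, abs_mul, abs_of_nonneg (by positivity)]
    simp; ring
  have h := hasDerivAt_tsum_of_isPreconnected (𝕜 := ℝ) (F := ℝ)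
    (g := fun n y => a n * y ^ n) (g' := fun n y => a n * (n * y ^ (n - 1)))
    (t := Metric.ball 0 (|t| + 1)) (y₀ := 0) (y := t) hu Metric.isOpen_ball
    (convex_ball _ _).isPreconnected
    (fun n y _ => (hasDerivAt_pow n y).const_mul _) (fun n y hy => by
      rw [norm_mul, norm_mul, norm_pow, Real.norm_eq_abs, Real.norm_eq_abs, Real.norm_eq_abs]
      have : |y| ≤ |t| + 1 := by simpa using (le_of_lt (mem_ball_zero_iff.1 hy))
      gcongr
      simp) (by simp; positivity) (ha.summable_powerSum 0) (by simp)
  refine HasDerivAt.congr_deriv (f := powerSum a) h ?_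
  have hs : Summable fun n : ℕ => a n * (n * t ^ (n - 1)) := by
    refine Summable.of_norm_bounded hu fun n => ?_
    rw [norm_mul, norm_mul, norm_pow, Real.norm_eq_abs, Real.norm_eq_abs, Real.norm_eq_abs]
    gcongr
    · simp
    · linarith
  rw [hs.tsum_eq_zero_add]
  simp [AnharmonicOscillator.derivCoeff, powerSum]
  exact tsum_congr fun n => by ring

/-- The Taylor coefficients at `0` of the solution of `y'' = t y`, `y 0 = α`, `y' 0 = β`. -/
noncomputable def airyCoeff (α β : ℝ) : ℕ → ℝ
  | 0 => α
  | 1 => β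
  | 2 => 0
  | n + 3 => airyCoeff α β n / ((n + 3) * (n + 2))

theorem rapidDecay_airyCoeff (α β : ℝ) : RapidDecay (airyCoeff α β) := by
  intro r hr
  -- Three steps of the recursion multiply the weighted coefficient by r³ / ((m+3)(m+2)), which is
  -- at most 1 once m ≥ N. The finitely many earlier terms therefore bound all of them.
  obtain ⟨N, hN⟩ := exists_nat_gt (r ^ 3)
  refine ⟨∑ i ∈ Finset.range (N + 3), |airyCoeff α β i| * r ^ i, fun n => ?_⟩
  induction n using Nat.strong_induction_on with
  | _ n ih =>
    rcases lt_or_ge n (N + 3) with h | h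
    · exact Finset.single_le_sum (f := fun i => |airyCoeff α β i| * r ^ i)
        (fun i _ => by positivity) (Finset.mem_range.2 h)
    · obtain ⟨m, rfl⟩ : ∃ m, n = m + 3 := ⟨n - 3, by omega⟩
      refine le_trans ?_ (ih m (by omega))
      have hm : (N : ℝ) ≤ m := by exact_mod_cast (by omega : N ≤ m)
      have h0 : (0 : ℝ) ≤ m := by positivity
      rw [airyCoeff, abs_div, abs_of_nonneg (by positivity : (0 : ℝ) ≤ (m + 3) * (m + 2)),
        div_mul_eq_mul_div, div_le_iff₀ (by positivity), pow_add, ← mul_assoc]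
      gcongr
      nlinarith

/-- The solution of Airy's equation `y'' = t y` with `y 0 = α`, `y' 0 = β`. -/
noncomputable def airySol (α β : ℝ) : ℝ → ℝ := powerSum (airyCoeff α β)

/-- The derivative of `airySol α β`. -/
noncomputable def airySolDeriv (α β : ℝ) : ℝ → ℝ := powerSum (derivCoeff (airyCoeff α β))

theorem hasDerivAt_airySol (α β t : ℝ) : HasDerivAt (airySol α β) (airySolDeriv α β t) t :=
  (rapidDecay_airyCoeff α β).hasDerivAt t

theorem hasDerivAt_airySolDeriv (α β t : ℝ) :
    HasDerivAt (airySolDeriv α β) (t * airySol α β t) t := by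
  have h := (rapidDecay_airyCoeff α β).derivCoeff.hasDerivAt t
  refine h.congr_deriv ?_
  have hs := (rapidDecay_airyCoeff α β).derivCoeff.derivCoeff.summable_powerSum t
  rw [powerSum, hs.tsum_eq_zero_add, airySol, powerSum, ← tsum_mul_left]
  simp only [derivCoeff, airyCoeff]
  norm_num
  refine tsum_congr fun n => ?_
  have h1 : (n : ℝ) + 3 ≠ 0 := by positivity
  have h2 : (n : ℝ) + 2 ≠ 0 := by positivity
  field_simp
  ring

theorem powerSum_zero (a : ℕ → ℝ) : powerSum a 0 = a 0 := by
  rw [powerSum, tsum_eq_single 0 (fun n hn => by simp [hn])]; simp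

theorem airySol_zero (α β : ℝ) : airySol α β 0 = α := by
  rw [airySol, powerSum_zero, airyCoeff]

theorem airySolDeriv_zero (α β : ℝ) : airySolDeriv α β 0 = β := by
  rw [airySolDeriv, powerSum_zero]; simp [derivCoeff, airyCoeff]

theorem airyCoeff_nonneg {α β : ℝ} (hα : 0 ≤ α) (hβ : 0 ≤ β) : ∀ n, 0 ≤ airyCoeff α β n
  | 0 => hα
  | 1 => hβ
  | 2 => le_rfl
  | n + 3 => by
    have := airyCoeff_nonneg hα hβ n
    rw [airyCoeff]; positivity

theorem le_powerSum {a : ℕ → ℝ} (ha : RapidDecay a) (h0 : ∀ n, 0 ≤ a n) {t : ℝ} (ht : 0 ≤ t)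
    (n : ℕ) : a n * t ^ n ≤ powerSum a t :=
  (ha.summable_powerSum t).le_tsum n fun m _ => mul_nonneg (h0 m) (by positivity)

theorem one_le_airySol {t : ℝ} (ht : 0 ≤ t) : 1 ≤ airySol 1 0 t := by
  simpa [airyCoeff, airySol] using le_powerSum (rapidDecay_airyCoeff 1 0)
    (airyCoeff_nonneg zero_le_one le_rfl) ht 0

theorem derivCoeff_airyCoeff_nonneg (n : ℕ) : 0 ≤ derivCoeff (airyCoeff 1 0) n :=
  mul_nonneg (by positivity) (airyCoeff_nonneg zero_le_one le_rfl _)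

theorem airySolDeriv_pos {t : ℝ} (ht : 0 < t) : 0 < airySolDeriv 1 0 t := by
  refine lt_of_lt_of_le ?_ (le_powerSum (rapidDecay_airyCoeff 1 0).derivCoeff
    derivCoeff_airyCoeff_nonneg ht.le 2)
  have : 0 < derivCoeff (airyCoeff 1 0) 2 := by simp [derivCoeff, airyCoeff]; norm_num
  positivity

/-! ### Wronskians and the decaying Airy solution -/

/-- The Wronskian of two solutions of `y'' = V y` is constant. -/
theorem wronskian_eq {V y y' z z' : ℝ → ℝ} (hy : ∀ t, HasDerivAt y (y' t) t)
    (hy' : ∀ t, HasDerivAt y' (V t * y t) t) (hz : ∀ t, HasDerivAt z (z' t) t)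
    (hz' : ∀ t, HasDerivAt z' (V t * z t) t) (s t : ℝ) :
    y s * z' s - y' s * z s = y t * z' t - y' t * z t := by
  have h : ∀ t, HasDerivAt (fun t => y t * z' t - y' t * z t) 0 t := fun t => by
    refine (((hy t).mul (hz' t)).sub ((hy' t).mul (hz t))).congr_deriv ?_
    ring
  exact is_const_of_deriv_eq_zero (fun t => (h t).differentiableAt) (fun t => (h t).deriv) s t

theorem airySol_wronskian (t : ℝ) :
    airySol 1 0 t * airySolDeriv 0 1 t - airySolDeriv 1 0 t * airySol 0 1 t = 1 := by
  rw [wronskian_eq (V := fun t => t) (hasDerivAt_airySol 1 0) (hasDerivAt_airySolDeriv 1 0)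
    (hasDerivAt_airySol 0 1) (hasDerivAt_airySolDeriv 0 1) t 0]
  simp [airySol_zero, airySolDeriv_zero]

theorem strictMonoOn_airyRatio :
    StrictMonoOn (fun t => airySol 0 1 t / airySol 1 0 t) (Set.Ici 0) := by
  have hF : ∀ t ∈ Set.Ici (0 : ℝ), airySol 1 0 t ≠ 0 := fun t ht => by
    have := one_le_airySol ht; positivity
  refine strictMonoOn_of_hasDerivWithinAt_pos (convex_Ici 0) (fun t ht =>
    ((hasDerivAt_airySol 0 1 t).div (hasDerivAt_airySol 1 0 t)
      (hF t ht)).continuousAt.continuousWithinAt)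
    (fun t ht => ((hasDerivAt_airySol 0 1 t).div (hasDerivAt_airySol 1 0 t)
      (hF t (interior_subset ht))).hasDerivWithinAt) fun t ht => ?_
  have h1 := airySol_wronskian t
  have h2 := hF t (interior_subset ht)
  refine div_pos ?_ (by positivity)
  linarith

theorem strictAntiOn_airyDerivRatio :
    StrictAntiOn (fun t => airySolDeriv 0 1 t / airySolDeriv 1 0 t) (Set.Ioi 0) := by
  have hF : ∀ t ∈ Set.Ioi (0 : ℝ), airySolDeriv 1 0 t ≠ 0 := fun t ht => (airySolDeriv_pos ht).ne'
  refine strictAntiOn_of_hasDerivWithinAt_neg (convex_Ioi 0) (fun t ht =>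
    ((hasDerivAt_airySolDeriv 0 1 t).div (hasDerivAt_airySolDeriv 1 0 t)
      (hF t ht)).continuousAt.continuousWithinAt)
    (fun t ht => ((hasDerivAt_airySolDeriv 0 1 t).div (hasDerivAt_airySolDeriv 1 0 t)
      (hF t (interior_subset ht))).hasDerivWithinAt) fun t ht => ?_
  have h1 := airySol_wronskian t
  have h2 := hF t (interior_subset ht)
  have h3 : 0 < t := by simpa using ht
  refine div_neg_of_neg_of_pos ?_ (by positivity)
  nlinarith

/-- At a common point this is the Wronskian identity; the opposite monotonicities of the two
quotients carry it to distinct points through their maximum. The slope separating the quotients is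
the coefficient that makes `airy` positive and decreasing. -/
theorem airyRatio_lt {s t : ℝ} (hs : 0 ≤ s) (ht : 0 < t) :
    airySol 0 1 s / airySol 1 0 s < airySolDeriv 0 1 t / airySolDeriv 1 0 t := by
  have key : ∀ r, 0 < r → airySol 0 1 r / airySol 1 0 r < airySolDeriv 0 1 r / airySolDeriv 1 0 r := by
    intro r hr
    have h1 := airySol_wronskian r
    have h2 := one_le_airySol hr.le
    rw [div_lt_div_iff₀ (by linarith) (airySolDeriv_pos hr)]
    linarith
  have hm : 0 < max s t := lt_max_of_lt_right ht
  calc _ ≤ airySol 0 1 (max s t) / airySol 1 0 (max s t) :=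
        strictMonoOn_airyRatio.monotoneOn hs hm.le (le_max_left _ _)
    _ < _ := key _ hm
    _ ≤ _ := strictAntiOn_airyDerivRatio.antitoneOn ht hm (le_max_right _ _)

/-- The limit at `+∞` of the quotient of the two basic solutions of Airy's equation. -/
noncomputable def airyConst : ℝ :=
  sSup ((fun t => airySol 0 1 t / airySol 1 0 t) '' Set.Ici 0)

/-- The solution of Airy's equation that decays at `+∞`, with derivative `-1` at `0`. -/
noncomputable def airy (t : ℝ) : ℝ := airyConst * airySol 1 0 t - airySol 0 1 t

/-- The derivative of `airy`. -/
noncomputable def airyDeriv (t : ℝ) : ℝ := airyConst * airySolDeriv 1 0 t - airySolDeriv 0 1 t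

theorem hasDerivAt_airy (t : ℝ) : HasDerivAt airy (airyDeriv t) t :=
  ((hasDerivAt_airySol 1 0 t).const_mul _).sub (hasDerivAt_airySol 0 1 t)

theorem hasDerivAt_airyDeriv (t : ℝ) : HasDerivAt airyDeriv (t * airy t) t := by
  refine (((hasDerivAt_airySolDeriv 1 0 t).const_mul airyConst).sub
    (hasDerivAt_airySolDeriv 0 1 t)).congr_deriv ?_
  rw [airy]; ring

theorem continuous_airy : Continuous airy :=
  continuous_iff_continuousAt.2 fun t => (hasDerivAt_airy t).continuousAt

theorem airyDeriv_zero : airyDeriv 0 = -1 := by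
  simp [airyDeriv, airySolDeriv_zero]

theorem airyRatio_lt_airyConst {s : ℝ} (hs : 0 ≤ s) :
    airySol 0 1 s / airySol 1 0 s < airyConst := by
  have hb : BddAbove ((fun t => airySol 0 1 t / airySol 1 0 t) '' Set.Ici 0) := by
    refine ⟨airySolDeriv 0 1 1 / airySolDeriv 1 0 1, ?_⟩
    rintro _ ⟨t, ht, rfl⟩
    exact (airyRatio_lt ht one_pos).le
  calc _ < airySol 0 1 (s + 1) / airySol 1 0 (s + 1) :=
        strictMonoOn_airyRatio hs (by simp; linarith) (by linarith)
    _ ≤ _ := le_csSup hb ⟨s + 1, by simp; linarith, rfl⟩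

theorem airyConst_le {t : ℝ} (ht : 0 < t) :
    airyConst ≤ airySolDeriv 0 1 t / airySolDeriv 1 0 t := by
  refine csSup_le (Set.nonempty_Ici.image _) ?_
  rintro _ ⟨s, hs, rfl⟩
  exact (airyRatio_lt hs ht).le

theorem airy_pos {t : ℝ} (ht : 0 ≤ t) : 0 < airy t := by
  have h := airyRatio_lt_airyConst ht
  have h2 := one_le_airySol ht
  rw [div_lt_iff₀ (by linarith)] at h
  rw [airy]; linarith

theorem airyDeriv_neg {t : ℝ} (ht : 0 ≤ t) : airyDeriv t < 0 := by
  -- The bound on `airyConst` gives only a weak inequality, and none at 0, where the quotient of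
  -- derivatives has a vanishing denominator. Evaluating one unit further and using that the
  -- derivative strictly increases repairs both.
  have h1 : airyDeriv (t + 1) ≤ 0 := by
    have h := airyConst_le (t := t + 1) (by linarith)
    rw [le_div_iff₀ (airySolDeriv_pos (by linarith))] at h
    rw [airyDeriv]; linarith
  have h2 : StrictMonoOn airyDeriv (Set.Ici 0) := by
    refine strictMonoOn_of_hasDerivWithinAt_pos (convex_Ici 0) (fun t _ =>
      (hasDerivAt_airyDeriv t).continuousAt.continuousWithinAt)
      (fun t _ => (hasDerivAt_airyDeriv t).hasDerivWithinAt) fun t ht => ?_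
    have h3 : 0 < t := by simpa using ht
    exact mul_pos h3 (airy_pos h3.le)
  exact (h2 ht (by simp; linarith) (by linarith)).trans_le h1

theorem antitoneOn_airy : AntitoneOn airy (Set.Ici 0) :=
  antitoneOn_of_hasDerivWithinAt_nonpos (convex_Ici 0) continuous_airy.continuousOn
    (fun t _ => (hasDerivAt_airy t).hasDerivWithinAt)
    fun _ ht => (airyDeriv_neg (interior_subset ht)).le

/-- On [0, T] the second derivative t a(t) is at least t a(T). Integrating, a' rises from -1 by at
least a(T) T²/2 and is still negative at T. -/
theorem airy_mul_sq_le {T : ℝ} (hT : 0 ≤ T) : airy T * T ^ 2 ≤ 2 := by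
  have h : MonotoneOn (fun t => airyDeriv t - airy T * t ^ 2 / 2) (Set.Icc 0 T) := by
    have hd : ∀ t, HasDerivAt (fun t => airyDeriv t - airy T * t ^ 2 / 2)
        (t * airy t - airy T * t) t := fun t => by
      refine ((hasDerivAt_airyDeriv t).sub
        (((hasDerivAt_pow 2 t).const_mul (airy T)).div_const 2)).congr_deriv ?_
      simp; ring
    refine monotoneOn_of_hasDerivWithinAt_nonneg (convex_Icc 0 T) (fun t _ =>
      (hd t).continuousAt.continuousWithinAt) (fun t _ => (hd t).hasDerivWithinAt) fun t ht => ?_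
    have ht' := interior_subset ht
    have := antitoneOn_airy ht'.1 hT ht'.2
    nlinarith [ht'.1]
  have h1 := h (Set.left_mem_Icc.2 hT) (Set.right_mem_Icc.2 hT) hT
  simp only [airyDeriv_zero] at h1
  linarith [airyDeriv_neg hT]

/-- By convexity the slope at T is at least the mean slope over [T - 1, T], and `airy` is positive
at T. Decay thus passes to the derivative. -/
theorem neg_airyDeriv_le {T : ℝ} (hT : 1 ≤ T) : -airyDeriv T ≤ airy (T - 1) := by
  obtain ⟨c, hc, h⟩ := exists_hasDerivAt_eq_slope airy airyDeriv (sub_one_lt T)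
    continuous_airy.continuousOn (fun t _ => hasDerivAt_airy t)
  have h2 : MonotoneOn airyDeriv (Set.Ici 0) := by
    refine monotoneOn_of_hasDerivWithinAt_nonneg (convex_Ici 0) (fun t _ =>
      (hasDerivAt_airyDeriv t).continuousAt.continuousWithinAt)
      (fun t _ => (hasDerivAt_airyDeriv t).hasDerivWithinAt) fun t ht => ?_
    have h3 : 0 < t := by simpa using ht
    exact (mul_pos h3 (airy_pos h3.le)).le
  have h3 := h2 (a := c) (b := T) (by simp; linarith [hc.1]) (by simp; linarith) hc.2.le
  rw [h] at h3
  have := airy_pos (t := T) (by linarith)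
  have h4 : T - (T - 1) = 1 := by ring
  rw [h4, div_one] at h3
  linarith

theorem tendsto_airy : Tendsto airy atTop (nhds 0) := by
  refine squeeze_zero' (g := fun t : ℝ => 2 / t ^ 2)
    ((eventually_ge_atTop 0).mono fun t ht => (airy_pos ht).le)
    ((eventually_gt_atTop 0).mono fun t ht => ?_)
    (tendsto_const_nhds.div_atTop (tendsto_pow_atTop two_ne_zero))
  rw [le_div_iff₀ (by positivity)]
  exact airy_mul_sq_le ht.le

theorem tendsto_airyDeriv : Tendsto airyDeriv atTop (nhds 0) := by
  have h : Tendsto (fun t => -airyDeriv t) atTop (nhds 0) :=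
    squeeze_zero' ((eventually_ge_atTop 0).mono fun t ht => by linarith [airyDeriv_neg ht])
      ((eventually_ge_atTop 1).mono fun t ht => neg_airyDeriv_le ht)
      (tendsto_airy.comp (tendsto_atTop_add_const_right _ (-1) tendsto_id))
  simpa using h.neg

theorem tendsto_mul_airy_sq : Tendsto (fun t => t * airy t ^ 2) atTop (nhds 0) := by
  have h : Tendsto (fun t : ℝ => 2 / t * airy t) atTop (nhds (0 * 0)) :=
    (tendsto_const_nhds.div_atTop tendsto_id).mul tendsto_airy
  rw [zero_mul] at h
  refine squeeze_zero' ((eventually_ge_atTop 0).mono fun t ht => by positivity)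
    ((eventually_gt_atTop 0).mono fun t ht => ?_) h
  have h1 := airy_mul_sq_le ht.le
  have h2 := airy_pos ht.le
  rw [div_mul_eq_mul_div, le_div_iff₀ ht]
  nlinarith

/-! ### The tail mass and the reflected solution -/

theorem hasDerivAt_airy_primitive (t : ℝ) :
    HasDerivAt (fun t => t * airy t ^ 2 - airyDeriv t ^ 2) (airy t ^ 2) t := by
  refine (((hasDerivAt_id t).mul ((hasDerivAt_airy t).pow 2)).sub
    ((hasDerivAt_airyDeriv t).pow 2)).congr_deriv ?_
  simp; ring

theorem tendsto_airy_primitive :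
    Tendsto (fun t => t * airy t ^ 2 - airyDeriv t ^ 2) atTop (nhds 0) := by
  simpa using tendsto_mul_airy_sq.sub (tendsto_airyDeriv.pow 2)

/-- The integral of the square of `airy` over `(-s, ∞)`. -/
noncomputable def airyMass (s : ℝ) : ℝ := s * airy (-s) ^ 2 + airyDeriv (-s) ^ 2

theorem integrableOn_airy_sq (s : ℝ) : IntegrableOn (fun t => airy t ^ 2) (Set.Ioi (-s)) :=
  integrableOn_Ioi_deriv_of_nonneg' (fun t _ => hasDerivAt_airy_primitive t)
    (fun t _ => by positivity) tendsto_airy_primitive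

theorem integral_airy_sq (s : ℝ) : ∫ t in Set.Ioi (-s), airy t ^ 2 = airyMass s := by
  rw [integral_Ioi_of_hasDerivAt_of_nonneg' (fun t _ => hasDerivAt_airy_primitive t)
    (fun t _ => by positivity) tendsto_airy_primitive, airyMass]
  ring

/-- The function `airy`, reflected at `0`: it solves `b'' = -s b` and oscillates for `s > 0`. -/
noncomputable def osc (s : ℝ) : ℝ := airy (-s)

/-- The derivative of `osc`. -/
noncomputable def oscDeriv (s : ℝ) : ℝ := -airyDeriv (-s)

theorem hasDerivAt_osc (s : ℝ) : HasDerivAt osc (oscDeriv s) s := by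
  refine ((hasDerivAt_airy (-s)).comp s (hasDerivAt_neg s)).congr_deriv ?_
  rw [oscDeriv]; ring

theorem hasDerivAt_oscDeriv (s : ℝ) : HasDerivAt oscDeriv (-s * osc s) s := by
  refine ((hasDerivAt_airyDeriv (-s)).comp s (hasDerivAt_neg s)).neg.congr_deriv ?_
  rw [osc]; ring

theorem airyMass_eq (s : ℝ) : airyMass s = s * osc s ^ 2 + oscDeriv s ^ 2 := by
  rw [airyMass, osc, oscDeriv]; ring

theorem hasDerivAt_airyMass (s : ℝ) : HasDerivAt airyMass (osc s ^ 2) s := by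
  have h : airyMass = fun s => s * osc s ^ 2 + oscDeriv s ^ 2 := funext airyMass_eq
  rw [h]
  refine (((hasDerivAt_id s).mul ((hasDerivAt_osc s).pow 2)).add
    ((hasDerivAt_oscDeriv s).pow 2)).congr_deriv ?_
  simp; ring

theorem monotone_airyMass : Monotone airyMass :=
  monotone_of_hasDerivAt_nonneg hasDerivAt_airyMass fun s => sq_nonneg (osc s)

theorem airyMass_zero : airyMass 0 = 1 := by simp [airyMass, airyDeriv_zero]

theorem one_le_airyMass {s : ℝ} (hs : 0 ≤ s) : 1 ≤ airyMass s :=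
  airyMass_zero ▸ monotone_airyMass hs

/-- The derivative of the mass is b², and s b² is only one of the two nonnegative terms of the mass.
This comparison gives both pointwise estimates of the density. -/
theorem airyMass_div_anti {s t : ℝ} (hs : 0 < s) (hst : s ≤ t) :
    airyMass t / t ≤ airyMass s / s := by
  have h : AntitoneOn (fun s => airyMass s / s) (Set.Ioi 0) := by
    have hd : ∀ s ∈ Set.Ioi (0 : ℝ), HasDerivAt (fun s => airyMass s / s)
        ((osc s ^ 2 * s - airyMass s * 1) / s ^ 2) s :=
      fun s hs => (hasDerivAt_airyMass s).div (hasDerivAt_id s) (ne_of_gt hs)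
    refine antitoneOn_of_hasDerivWithinAt_nonpos (convex_Ioi 0) (fun s hs =>
      (hd s hs).continuousAt.continuousWithinAt)
      (fun s hs => (hd s (interior_subset hs)).hasDerivWithinAt) fun s hs => ?_
    refine div_nonpos_of_nonpos_of_nonneg ?_ (by positivity)
    rw [airyMass_eq]
    nlinarith [sq_nonneg (oscDeriv s)]
  exact h hs (hs.trans_le hst) hst

/-! ### Phase variables, growth of the mass and oscillation -/

/-- The squared sine of the phase of `osc`. -/
noncomputable def phaseSin (s : ℝ) : ℝ := s * osc s ^ 2 / airyMass s

/-- The squared cosine of the phase of `osc`. -/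
noncomputable def phaseCos (s : ℝ) : ℝ := oscDeriv s ^ 2 / airyMass s

/-- The product of sine and cosine of the phase of `osc`, divided by the square root of `s`. -/
noncomputable def phaseMix (s : ℝ) : ℝ := osc s * oscDeriv s / airyMass s

theorem phaseSin_add_phaseCos {s : ℝ} (hs : 0 ≤ s) : phaseSin s + phaseCos s = 1 := by
  have h := one_le_airyMass hs
  rw [phaseSin, phaseCos, ← add_div, ← airyMass_eq, div_self (by positivity)]

theorem phaseSin_nonneg {s : ℝ} (hs : 0 ≤ s) : 0 ≤ phaseSin s := by
  have h := one_le_airyMass hs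
  rw [phaseSin]; positivity

theorem phaseCos_nonneg {s : ℝ} (hs : 0 ≤ s) : 0 ≤ phaseCos s := by
  have h := one_le_airyMass hs
  rw [phaseCos]; positivity

theorem phaseMix_sq {s : ℝ} (hs : 0 ≤ s) : s * phaseMix s ^ 2 = phaseSin s * phaseCos s := by
  have h := one_le_airyMass hs
  rw [phaseMix, phaseSin, phaseCos]; field_simp

theorem mul_phaseMix_sq_le {s : ℝ} (hs : 0 ≤ s) : s * phaseMix s ^ 2 ≤ 1 / 4 := by
  rw [phaseMix_sq hs]
  nlinarith [phaseSin_add_phaseCos hs, sq_nonneg (phaseSin s - phaseCos s)]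

theorem abs_phaseMix_le {s : ℝ} (hs : 1 ≤ s) : |phaseMix s| ≤ 1 / 2 := by
  have h := mul_phaseMix_sq_le (zero_le_one.trans hs)
  refine abs_le_of_sq_le_sq ?_ (by norm_num)
  nlinarith [sq_nonneg (phaseMix s)]

theorem hasDerivAt_phaseCos {s : ℝ} (hs : 0 < s) :
    HasDerivAt phaseCos (-2 * s * phaseMix s - phaseCos s * phaseSin s / s) s := by
  have h := one_le_airyMass hs.le
  refine (((hasDerivAt_oscDeriv s).pow 2).div (hasDerivAt_airyMass s) (by positivity)).congr_deriv ?_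
  rw [phaseMix, phaseCos, phaseSin]
  field_simp
  simp; ring

theorem hasDerivAt_phaseMix {s : ℝ} (hs : 0 < s) :
    HasDerivAt phaseMix (phaseCos s - phaseSin s - phaseMix s * phaseSin s / s) s := by
  have h := one_le_airyMass hs.le
  refine (((hasDerivAt_osc s).mul (hasDerivAt_oscDeriv s)).div
    (hasDerivAt_airyMass s) (by positivity)).congr_deriv ?_
  rw [phaseMix, phaseCos, phaseSin]
  field_simp
  simp; ring

/-- The mass of `osc` on `(-∞, s)` grows like the square root of `s`. -/
theorem airyMass_growth {s t : ℝ} (hs : 1 ≤ s) (hst : s ≤ t) :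
    airyMass s ^ 2 / s ≤ Real.exp (3 / 2) * (airyMass t ^ 2 / t) := by
  -- The logarithm of M²/s has derivative (sin²θ - cos²θ)/s. Adding `phaseMix s / s` cancels this
  -- oscillating term up to O(1/s²), and the term -1/s, with derivative 1/s², makes the remainder
  -- nonnegative. The correction lies in [-3/2, 0], whence the constant exp (3/2).
  set L : ℝ → ℝ := fun s => 2 * Real.log (airyMass s) - Real.log s + (phaseMix s - 1) / s with hL
  have hd : ∀ s ∈ Set.Ici (1 : ℝ), HasDerivAt L
      (2 * (osc s ^ 2 / airyMass s) - 1 / s + ((phaseCos s - phaseSin s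
        - phaseMix s * phaseSin s / s) * s - (phaseMix s - 1) * 1) / s ^ 2) s := fun s hs => by
    have hs0 : (0 : ℝ) < s := lt_of_lt_of_le one_pos hs
    have h := one_le_airyMass hs0.le
    have h1 := (hasDerivAt_airyMass s).log (by positivity)
    have h2 := (hasDerivAt_id s).log hs0.ne'
    exact ((h1.const_mul 2).sub h2).add
      (((hasDerivAt_phaseMix hs0).sub_const 1).div (hasDerivAt_id s) hs0.ne')
  have hm : MonotoneOn L (Set.Ici 1) := by
    refine monotoneOn_of_hasDerivWithinAt_nonneg (convex_Ici 1) (fun s hs =>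
      (hd s hs).continuousAt.continuousWithinAt)
      (fun s hs => (hd s (interior_subset hs)).hasDerivWithinAt) fun s hs => ?_
    have hs1 : 1 ≤ s := interior_subset hs
    have hs0 : (0 : ℝ) < s := by linarith
    have hP := one_le_airyMass hs0.le
    have h1 : osc s ^ 2 / airyMass s = phaseSin s / s := by rw [phaseSin]; field_simp
    have h2 := phaseSin_add_phaseCos hs0.le
    have h3 : 2 * (osc s ^ 2 / airyMass s) - 1 / s + ((phaseCos s - phaseSin s
        - phaseMix s * phaseSin s / s) * s - (phaseMix s - 1) * 1) / s ^ 2 =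
        (1 - phaseMix s * (1 + phaseSin s)) / s ^ 2 := by
      rw [h1, show phaseCos s = 1 - phaseSin s by linarith]
      field_simp; ring
    rw [h3]
    have h4 := abs_le.1 (abs_phaseMix_le hs1)
    have h5 := phaseSin_nonneg hs0.le
    have h6 := phaseCos_nonneg hs0.le
    refine div_nonneg ?_ (by positivity)
    nlinarith
  have ht : 1 ≤ t := hs.trans hst
  have h := hm hs ht hst
  have hPs := one_le_airyMass (s := s) (by linarith)
  have hPt := one_le_airyMass (s := t) (by linarith)
  have h1 : (phaseMix t - 1) / t ≤ 0 :=
    div_nonpos_of_nonpos_of_nonneg (by linarith [(abs_le.1 (abs_phaseMix_le ht)).2]) (by linarith)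
  have h2 : -(3 / 2) ≤ (phaseMix s - 1) / s := by
    rw [le_div_iff₀ (by linarith)]
    nlinarith [(abs_le.1 (abs_phaseMix_le hs)).1]
  have h3 : ∀ r, 1 ≤ r → 1 ≤ airyMass r →
      Real.log (airyMass r ^ 2 / r) = 2 * Real.log (airyMass r) - Real.log r := fun r hr hP => by
    rw [Real.log_div (by positivity) (by positivity), Real.log_pow]; norm_num
  have h4 : Real.log (airyMass s ^ 2 / s) ≤ 3 / 2 + Real.log (airyMass t ^ 2 / t) := by
    rw [h3 s hs hPs, h3 t ht hPt]
    simp only [hL] at h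
    linarith
  have h5 : 0 < airyMass s ^ 2 / s := by positivity
  have h6 : 0 < airyMass t ^ 2 / t := by positivity
  rw [← Real.exp_log h5, ← Real.exp_log h6, ← Real.exp_add]
  exact Real.exp_le_exp.2 h4

/-- Every interval of length `4` in `[1, ∞)` contains a zero of the derivative of `osc`. -/
theorem exists_oscDeriv_eq_zero {s : ℝ} (hs : 1 ≤ s) :
    ∃ t ∈ Set.Icc s (s + 4), oscDeriv t = 0 := by
  by_contra! hne
  -- The angle with tangent b/b' turns at speed (b'² + t b²)/(b'² + b²) ≥ 1. Without a zero of b'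
  -- the arctangent would follow it continuously and gain 4 > π, more than its range allows.
  set g : ℝ → ℝ := fun t => Real.arctan (osc t / oscDeriv t) - t
  have hd : ∀ t ∈ Set.Icc s (s + 4), HasDerivAt g
      (1 / (1 + (osc t / oscDeriv t) ^ 2) *
        ((oscDeriv t * oscDeriv t - osc t * (-t * osc t)) / oscDeriv t ^ 2) - 1) t := fun t ht =>
    (((hasDerivAt_osc t).div (hasDerivAt_oscDeriv t) (hne t ht)).arctan).sub (hasDerivAt_id t)
  have hm : MonotoneOn g (Set.Icc s (s + 4)) := by
    refine monotoneOn_of_hasDerivWithinAt_nonneg (convex_Icc _ _) (fun t ht =>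
      (hd t ht).continuousAt.continuousWithinAt)
      (fun t ht => (hd t (interior_subset ht)).hasDerivWithinAt) fun t ht => ?_
    have ht' := interior_subset ht
    have h0 := hne t ht'
    have h1 : 1 ≤ t := hs.trans ht'.1
    rw [sub_nonneg, div_mul_div_comm, one_mul, le_div_iff₀ (by positivity)]
    field_simp
    nlinarith [sq_nonneg (osc t)]
  have h := hm (Set.left_mem_Icc.2 (by linarith)) (Set.right_mem_Icc.2 (by linarith))
    (by linarith : s ≤ s + 4)
  have h1 := Real.neg_pi_div_two_lt_arctan (osc s / oscDeriv s)
  have h2 := Real.arctan_lt_pi_div_two (osc (s + 4) / oscDeriv (s + 4))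
  have h3 := Real.pi_lt_four
  simp only [g] at h
  linarith

/-- The values `s` for which `osc` or its derivative vanishes. -/
def oscZeros : Set ℝ := {s | osc s = 0 ∨ oscDeriv s = 0}

theorem oscZeros_pos {s : ℝ} (hs : s ∈ oscZeros) : 0 < s := by
  by_contra! h
  rcases hs with hs | hs
  · exact (airy_pos (t := -s) (by linarith)).ne' hs
  · have := airyDeriv_neg (t := -s) (by linarith)
    rw [oscDeriv] at hs; linarith

/-- These points are the zeros of b b', and they are simple: its derivative is b'² - s b², where
exactly one term vanishes because the mass is at least 1 and s > 0. Simple zeros cannot accumulate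
in a compact interval. -/
theorem finite_oscZeros_inter (M : ℝ) : (oscZeros ∩ Set.Iic M).Finite := by
  set g : ℝ → ℝ := fun s => osc s * oscDeriv s with hg
  have hd : ∀ s, HasDerivAt g (oscDeriv s ^ 2 - s * osc s ^ 2) s := fun s => by
    refine ((hasDerivAt_osc s).mul (hasDerivAt_oscDeriv s)).congr_deriv ?_
    ring
  have hmem : ∀ s, s ∈ oscZeros ↔ g s = 0 := fun s => by
    simp only [oscZeros, hg, mul_eq_zero, Set.mem_ofPred_eq]
  have hsub : oscZeros ∩ Set.Iic M ⊆ oscZeros ∩ Set.Icc 0 M :=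
    fun s hs => ⟨hs.1, (oscZeros_pos hs.1).le, hs.2⟩
  refine Set.Finite.subset ?_ hsub
  by_contra hinf
  obtain ⟨x, -, hx⟩ := Set.Infinite.exists_accPt_of_subset_isCompact hinf isCompact_Icc
    Set.inter_subset_right
  have hfreq : ∃ᶠ y in nhdsWithin x {x}ᶜ, y ∈ oscZeros :=
    (accPt_iff_frequently_nhdsNE.1 hx).mono fun y hy => hy.1
  have hclosed : IsClosed oscZeros := by
    have : oscZeros = g ⁻¹' {0} := by ext s; simp [hmem]
    rw [this]
    exact isClosed_singleton.preimage
      (continuous_iff_continuousAt.2 fun s => (hd s).continuousAt)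
  have hxz : x ∈ oscZeros :=
    hclosed.mem_of_frequently_of_tendsto hfreq (tendsto_id.mono_left nhdsWithin_le_nhds)
  have hx0 := oscZeros_pos hxz
  have hP := one_le_airyMass hx0.le
  rw [airyMass_eq] at hP
  have hne : oscDeriv x ^ 2 - x * osc x ^ 2 ≠ 0 := by
    rcases hxz with h | h
    · rw [h] at hP ⊢; intro h2; simp at h2; simp [h2] at hP; linarith
    · rw [h] at hP ⊢; intro h2; simp at hP h2
      rcases h2 with h2 | h2
      · exact hx0.ne' h2
      · simp [h2] at hP; linarith
  exact hfreq (((hd x).eventually_ne (c := 0) hne).mono fun y hy h => hy ((hmem y).1 h))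

theorem countable_oscZeros : oscZeros.Countable := by
  have h : oscZeros = ⋃ n : ℕ, oscZeros ∩ Set.Iic n := by
    ext s
    simp only [Set.mem_iUnion, Set.mem_inter_iff, Set.mem_Iic, exists_and_left]
    exact ⟨fun h => ⟨h, exists_nat_ge s⟩, fun h => h.1⟩
  rw [h]
  exact Set.countable_iUnion fun n => (finite_oscZeros_inter n).countable

/-! ### Wallis recursion and distribution of the phase -/

theorem phaseCos_le_one {s : ℝ} (hs : 0 ≤ s) : phaseCos s ≤ 1 := by
  linarith [phaseSin_add_phaseCos hs, phaseSin_nonneg hs]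

theorem continuousOn_phaseCos {s t : ℝ} (hs : 0 < s) (hst : s ≤ t) :
    ContinuousOn phaseCos (Set.uIcc s t) := fun r hr => by
  rw [Set.uIcc_of_le hst] at hr
  exact (hasDerivAt_phaseCos (hs.trans_le hr.1)).continuousAt.continuousWithinAt

theorem intervalIntegrable_phaseCos_pow (n : ℕ) {s t : ℝ} (hs : 0 < s) (hst : s ≤ t) :
    IntervalIntegrable (fun s => phaseCos s ^ n) volume s t :=
  ((continuousOn_phaseCos hs hst).pow n).intervalIntegrable

/-- This is the Wallis integration by parts in differential form: up to an error of order s^(-3/2),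
the combination (2n+2) cos²ⁿ⁺²θ - (2n+1) cos²ⁿθ is the derivative of a bounded function. -/
theorem hasDerivAt_phaseMix_mul_pow (n : ℕ) {s : ℝ} (hs : 0 < s) :
    HasDerivAt (fun s => phaseMix s * phaseCos s ^ n)
      ((2 * n + 2) * phaseCos s ^ (n + 1) - (2 * n + 1) * phaseCos s ^ n
        - (n + 1) * (phaseMix s * phaseCos s ^ n * phaseSin s / s)) s := by
  refine ((hasDerivAt_phaseMix hs).mul ((hasDerivAt_phaseCos hs).pow n)).congr_deriv ?_
  have h1 := phaseMix_sq hs.le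
  have h2 : phaseSin s = 1 - phaseCos s := by linarith [phaseSin_add_phaseCos hs.le]
  rw [h2] at h1 ⊢
  rcases n with _ | n
  · simp; ring
  · simp only [Nat.add_sub_cancel, Pi.pow_apply]
    have h3 : phaseMix s * ((n + 1 : ℕ) * phaseCos s ^ n *
        (-2 * s * phaseMix s - phaseCos s * (1 - phaseCos s) / s)) =
        (n + 1) * phaseCos s ^ n * (-2 * (s * phaseMix s ^ 2)
          - phaseMix s * phaseCos s * (1 - phaseCos s) / s) := by
      push_cast; ring
    rw [h3, h1]
    push_cast
    ring

theorem hasDerivAt_inv_sqrt {s : ℝ} (hs : 0 < s) :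
    HasDerivAt (fun s => (Real.sqrt s)⁻¹) (-(1 / (2 * s * Real.sqrt s))) s := by
  refine ((Real.hasDerivAt_sqrt hs.ne').inv (Real.sqrt_pos.2 hs).ne').congr_deriv ?_
  rw [Real.sq_sqrt hs.le]
  field_simp

theorem integral_phaseCos_step (n : ℕ) {t : ℝ} (ht : 1 ≤ t) :
    (2 * n + 2) * (∫ s in (1 : ℝ)..t, phaseCos s ^ (n + 1)) ≤
      (2 * n + 1) * (∫ s in (1 : ℝ)..t, phaseCos s ^ n) + (n + 2) := by
  -- The inverse square root has derivative of order s^(-3/2) and dominates the error, since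
  -- |`phaseMix s`| ≤ 1/(2√s). The boundary terms contribute at most 1/2 + 1/2 + (n + 1) = n + 2.
  set h : ℝ → ℝ := fun s => phaseMix s * phaseCos s ^ n - (n + 1) * (Real.sqrt s)⁻¹ with hh
  have hd : ∀ s ∈ Set.Icc 1 t, HasDerivAt h
      ((2 * n + 2) * phaseCos s ^ (n + 1) - (2 * n + 1) * phaseCos s ^ n
        - (n + 1) * (phaseMix s * phaseCos s ^ n * phaseSin s / s)
        - (n + 1) * -(1 / (2 * s * Real.sqrt s))) s := fun s hs => by
    have hs0 : 0 < s := by linarith [hs.1]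
    exact (hasDerivAt_phaseMix_mul_pow n hs0).sub ((hasDerivAt_inv_sqrt hs0).const_mul _)
  have hi : ∀ m, IntervalIntegrable (fun s => phaseCos s ^ m) volume 1 t := fun m =>
    intervalIntegrable_phaseCos_pow m one_pos ht
  have key : (∫ s in (1 : ℝ)..t, ((2 * n + 2) * phaseCos s ^ (n + 1)
      - (2 * n + 1) * phaseCos s ^ n)) ≤ h t - h 1 := by
    refine intervalIntegral.integral_le_sub_of_hasDeriv_right_of_le ht
      (fun s hs => (hd s hs).continuousAt.continuousWithinAt)
      (fun s hs => (hd s (Set.Ioo_subset_Icc_self hs)).hasDerivWithinAt) ?_ fun s hs => ?_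
    · exact (intervalIntegrable_iff_integrableOn_Icc_of_le ht).1
        (((hi (n + 1)).const_mul _).sub ((hi n).const_mul _))
    · have hs1 : 1 ≤ s := hs.1.le
      have hs0 : 0 < s := by linarith
      have h0 : 0 < Real.sqrt s := Real.sqrt_pos.2 hs0
      have h1 : phaseMix s * Real.sqrt s ≤ 1 / 2 := by
        refine (abs_le.1 (abs_le_of_sq_le_sq (a := phaseMix s * Real.sqrt s) ?_ (by norm_num))).2
        rw [mul_pow, Real.sq_sqrt hs0.le]
        linarith [mul_phaseMix_sq_le hs0.le]
      have h2 : 0 ≤ phaseCos s ^ n := pow_nonneg (phaseCos_nonneg hs0.le) n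
      have h3 : phaseCos s ^ n ≤ 1 := pow_le_one₀ (phaseCos_nonneg hs0.le) (phaseCos_le_one hs0.le)
      have h4 := phaseSin_nonneg hs0.le
      have h5 : phaseSin s ≤ 1 := by linarith [phaseSin_add_phaseCos hs0.le, phaseCos_nonneg hs0.le]
      have h6 : phaseMix s * phaseCos s ^ n * phaseSin s / s ≤ 1 / (2 * s * Real.sqrt s) := by
        rw [div_le_div_iff₀ hs0 (by positivity)]
        have h7 : 0 ≤ phaseCos s ^ n * phaseSin s := by positivity
        have h8 : phaseCos s ^ n * phaseSin s ≤ 1 := mul_le_one₀ h3 h4 h5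
        have h9 : (phaseMix s * Real.sqrt s) * (phaseCos s ^ n * phaseSin s) ≤ 1 / 2 := by
          nlinarith
        nlinarith
      nlinarith [mul_le_mul_of_nonneg_left h6 (by positivity : (0 : ℝ) ≤ n + 1)]
  rw [intervalIntegral.integral_sub ((hi (n + 1)).const_mul _) ((hi n).const_mul _),
    intervalIntegral.integral_const_mul, intervalIntegral.integral_const_mul] at key
  have hb : ∀ s, 1 ≤ s → |phaseMix s * phaseCos s ^ n| ≤ 1 / 2 := fun s hs => by
    have hs0 : 0 ≤ s := by linarith
    rw [abs_mul, abs_of_nonneg (pow_nonneg (phaseCos_nonneg hs0) n)]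
    have h3 : phaseCos s ^ n ≤ 1 := pow_le_one₀ (phaseCos_nonneg hs0) (phaseCos_le_one hs0)
    calc _ ≤ |phaseMix s| * 1 := by gcongr
      _ ≤ 1 / 2 := by rw [mul_one]; exact abs_phaseMix_le hs
  have h1 := (abs_le.1 (hb t ht)).2
  have h2 := (abs_le.1 (hb 1 le_rfl)).1
  have h3 : 0 ≤ (n + 1) * (Real.sqrt t)⁻¹ := by positivity
  simp only [hh, Real.sqrt_one, inv_one] at key
  linarith

/-- Each step multiplies the leading coefficient by (2n+1)/(2n+2), which is at most √((n+1)/(n+2)).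
Only the fact that this coefficient tends to 0 as n grows matters later. -/
theorem integral_phaseCos_pow_le (n : ℕ) : ∃ C : ℝ, ∀ t, 1 ≤ t →
    ∫ s in (1 : ℝ)..t, phaseCos s ^ n ≤ t / Real.sqrt (n + 1) + C := by
  induction n with
  | zero => exact ⟨0, fun t ht => by simp⟩
  | succ n ih =>
    obtain ⟨C, hC⟩ := ih
    refine ⟨((2 * n + 1) * C + (n + 2)) / (2 * n + 2), fun t ht => ?_⟩
    have h1 := integral_phaseCos_step n ht
    have h2 := hC t ht
    have hr : (2 * n + 1 : ℝ) / Real.sqrt (n + 1) ≤ (2 * n + 2) / Real.sqrt ((n + 1 : ℕ) + 1) := by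
      rw [div_le_div_iff₀ (by positivity) (by positivity)]
      refine (pow_le_pow_iff_left₀ (by positivity) (by positivity) two_ne_zero).1 ?_
      rw [mul_pow, mul_pow, Real.sq_sqrt (by positivity), Real.sq_sqrt (by positivity)]
      push_cast
      nlinarith [(by positivity : (0 : ℝ) ≤ n)]
    have h3 : (2 * n + 2) * (∫ s in (1 : ℝ)..t, phaseCos s ^ (n + 1)) ≤
        (2 * n + 2) * (t / Real.sqrt ((n + 1 : ℕ) + 1)) + ((2 * n + 1) * C + (n + 2)) := by
      have h4 : (2 * n + 1) * (∫ s in (1 : ℝ)..t, phaseCos s ^ n) ≤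
          (2 * n + 1) * (t / Real.sqrt (n + 1) + C) := by gcongr
      have h5 := mul_le_mul_of_nonneg_left hr (by linarith : 0 ≤ t)
      have h6 : t * ((2 * n + 1) / Real.sqrt (n + 1)) = (2 * n + 1) * (t / Real.sqrt (n + 1)) := by
        ring
      have h7 : t * ((2 * n + 2) / Real.sqrt ((n + 1 : ℕ) + 1)) =
          (2 * n + 2) * (t / Real.sqrt ((n + 1 : ℕ) + 1)) := by ring
      linarith
    have h8 : (0 : ℝ) < 2 * n + 2 := by positivity
    rw [← mul_le_mul_iff_right₀ h8]
    refine h3.trans (le_of_eq ?_)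
    field_simp

/-- The phase of `osc` is rarely close to a multiple of `π`. -/
theorem volume_phaseSin_lt (δ : ℝ) (hδ : 0 < δ) : ∃ ε : ℝ, 0 < ε ∧ ∃ C : ℝ, ∀ t, 1 ≤ t →
    volume.real {s | s ∈ Set.Icc 0 t ∧ phaseSin s < ε} ≤ δ * t + C := by
  obtain ⟨n, hn⟩ := exists_nat_gt ((2 / δ) ^ 2)
  obtain ⟨C, hC⟩ := integral_phaseCos_pow_le n
  -- If sin²θ < 1/(2(n+1)), Bernoulli's inequality gives cos²ⁿθ ≥ 1/2, so Markov's inequality costs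
  -- a factor 2. The extra 1 covers [0, 1], outside the range of the integral estimate.
  refine ⟨1 / (2 * (n + 1)), by positivity, 2 * C + 1, fun t ht => ?_⟩
  have hroot : 2 / Real.sqrt (n + 1) ≤ δ := by
    rw [div_le_iff₀ (by positivity), ← div_le_iff₀' hδ]
    exact Real.le_sqrt_of_sq_le (by linarith)
  set Z := {s | phaseSin s < 1 / (2 * ((n : ℝ) + 1))}
  have hint := intervalIntegrable_phaseCos_pow n one_pos ht
  rw [intervalIntegrable_iff_integrableOn_Icc_of_le ht] at hint
  have hmarkov := mul_meas_ge_le_integral_of_nonneg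
    (μ := volume.restrict (Set.Icc 1 t)) (f := fun s => phaseCos s ^ n)
    ((ae_restrict_mem measurableSet_Icc).mono fun s hs =>
      pow_nonneg (phaseCos_nonneg (by linarith [hs.1])) n) hint (1 / 2)
  have hI : ∫ s in Set.Icc 1 t, phaseCos s ^ n = ∫ s in (1 : ℝ)..t, phaseCos s ^ n := by
    rw [intervalIntegral.integral_of_le ht, integral_Icc_eq_integral_Ioc]
  rw [hI, measureReal_restrict_apply' measurableSet_Icc] at hmarkov
  have hsub : {s | s ∈ Set.Icc 0 t ∧ phaseSin s < 1 / (2 * ((n : ℝ) + 1))} ⊆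
      Set.Icc 0 1 ∪ ({s | 1 / 2 ≤ phaseCos s ^ n} ∩ Set.Icc 1 t) := by
    rintro s ⟨⟨hs0, hst⟩, hs⟩
    rcases le_total s 1 with h | h
    · exact Or.inl ⟨hs0, h⟩
    · refine Or.inr ⟨?_, h, hst⟩
      have h1 : phaseCos s = 1 + -phaseSin s := by linarith [phaseSin_add_phaseCos hs0]
      have h3 : phaseSin s ≤ 1 := by linarith [phaseSin_add_phaseCos hs0, phaseCos_nonneg hs0]
      have h2 := one_add_mul_le_pow (a := -phaseSin s) (by linarith) n
      rw [lt_div_iff₀ (by positivity)] at hs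
      have h4 := phaseSin_nonneg hs0
      simp only [Set.mem_ofPred_eq, h1]
      nlinarith
  have hfin : volume (Set.Icc 0 1 ∪ ({s | 1 / 2 ≤ phaseCos s ^ n} ∩ Set.Icc 1 t)) ≠ ⊤ := by
    refine ne_top_of_le_ne_top ?_ (measure_mono (t := Set.Icc 0 1 ∪ Set.Icc 1 t)
      (Set.union_subset_union_right _ Set.inter_subset_right))
    exact (isCompact_Icc.union isCompact_Icc).measure_lt_top.ne
  have hle := (measureReal_mono hsub hfin).trans (measureReal_union_le _ _)
  have h01 : volume.real (Set.Icc (0 : ℝ) 1) = 1 := by simp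
  have h2 := hC t ht
  have h3 := mul_le_mul_of_nonneg_left hroot (by linarith : 0 ≤ t)
  have h4 : t * (2 / Real.sqrt (n + 1)) = 2 * (t / Real.sqrt (n + 1)) := by ring
  linarith

/-! ### Position densities and their mass on sets -/

theorem integrable_comp_abs {g : ℝ → ℝ} (hg : IntegrableOn g (Set.Ioi 0)) :
    Integrable fun x => g |x| := by
  have h1 : IntegrableOn (fun x => g |x|) (Set.Ioi 0) :=
    hg.congr_fun (fun x hx => by rw [abs_of_pos (show 0 < x from hx)]) measurableSet_Ioi
  have h2 : IntegrableOn (fun x => g |x|) (Set.Iio 0) := by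
    have := (IntegrableOn.comp_neg_Iio (c := (0 : ℝ)) (f := fun x => g |x|) (by simpa using h1))
    simpa using this
  rw [← integrableOn_univ, ← Set.Iic_union_Ioi (a := (0 : ℝ))]
  exact ((integrableOn_Iic_iff_integrableOn_Iio).2 h2).union h1

theorem integral_indicator_comp_abs (g : ℝ → ℝ) {a : ℝ} (ha : 0 ≤ a) :
    ∫ x in {x | a < |x|}, g |x| = 2 * ∫ x in Set.Ioi a, g x := by
  have h := integral_comp_abs (f := (Set.Ioi a).indicator g)
  rw [setIntegral_indicator measurableSet_Ioi, Set.Ioi_inter_Ioi, max_eq_right ha] at h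
  have hm : MeasurableSet {x : ℝ | a < |x|} := measurableSet_lt measurable_const measurable_id.abs
  rw [← h, ← integral_indicator hm]
  rfl

/-- The probability density of the position of an eigenstate with eigenvalue `l`. -/
noncomputable def density (l x : ℝ) : ℝ := airy (|x| - l) ^ 2 / (2 * airyMass l)

theorem integrableOn_airy_sub_sq (l a : ℝ) :
    IntegrableOn (fun x => airy (x - l) ^ 2) (Set.Ioi a) := by
  have h : IntegrableOn (fun x => airy x ^ 2) (Set.Ioi (a - l)) := by
    simpa using integrableOn_airy_sq (-(a - l))
  have := (measurePreserving_sub_right volume l).integrableOn_comp_preimage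
    (measurableEmbedding_subRight l) (f := fun x => airy x ^ 2) (s := Set.Ioi (a - l))
  simp only [Set.preimage_sub_const_Ioi, sub_add_cancel] at this
  exact this.2 h

theorem integral_airy_sub_sq (l a : ℝ) :
    ∫ x in Set.Ioi a, airy (x - l) ^ 2 = airyMass (l - a) := by
  have := (measurePreserving_sub_right volume l).setIntegral_preimage_emb
    (measurableEmbedding_subRight l) (fun x => airy x ^ 2) (Set.Ioi (a - l))
  simp only [Set.preimage_sub_const_Ioi, sub_add_cancel] at this
  rw [this, ← integral_airy_sq, neg_sub]

theorem integrable_density (l : ℝ) : Integrable (density l) :=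
  (integrable_comp_abs (integrableOn_airy_sub_sq l 0)).div_const _

theorem density_nonneg {l : ℝ} (hl : 0 ≤ l) (x : ℝ) : 0 ≤ density l x := by
  have := one_le_airyMass hl
  rw [density]; positivity

theorem integral_airy_abs_sub_sq (l : ℝ) : ∫ x, airy (|x| - l) ^ 2 = 2 * airyMass l := by
  rw [integral_comp_abs (f := fun x => airy (x - l) ^ 2), integral_airy_sub_sq, sub_zero]

theorem setIntegral_density_tail {l s : ℝ} (hl : 0 ≤ l) (hs : s ≤ l) :
    ∫ x in {x | l - s < |x|}, density l x = airyMass s / airyMass l := by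
  have := one_le_airyMass hl
  simp only [density]
  rw [integral_indicator_comp_abs (fun x => airy (x - l) ^ 2 / (2 * airyMass l))
    (sub_nonneg.2 hs), integral_div, integral_airy_sub_sq, sub_sub_cancel]
  field_simp

theorem density_eq {l x : ℝ} : density l x = osc (l - |x|) ^ 2 / (2 * airyMass l) := by
  rw [density, osc, neg_sub]

/-- With s = l - |x| one has b(s)² = sin²θ(s) · M(s)/s, and M(s)/s is at least M(l)/l. The amplitude
is thus smallest at the centre of the well, and only the phase can make the density small. -/
theorem phaseSin_le_density {l x : ℝ} (hl : 0 < l) (hx : |x| ≤ l) :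
    phaseSin (l - |x|) / (2 * l) ≤ density l x := by
  have hP := one_le_airyMass hl.le
  rcases hx.eq_or_lt with h | h
  · rw [h, sub_self, phaseSin]
    simpa using density_nonneg hl.le x
  · have hs : 0 < l - |x| := by linarith
    have hPs := one_le_airyMass hs.le
    have h1 := airyMass_div_anti hs (by linarith [abs_nonneg x] : l - |x| ≤ l)
    rw [density_eq]
    have h2 : osc (l - |x|) ^ 2 = phaseSin (l - |x|) * (airyMass (l - |x|) / (l - |x|)) := by
      rw [phaseSin]; field_simp
    have h3 := mul_le_mul_of_nonneg_left h1 (phaseSin_nonneg hs.le)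
    rw [h2, div_le_div_iff₀ (by positivity) (by positivity)]
    have h4 : phaseSin (l - |x|) * (airyMass l / l) * l = phaseSin (l - |x|) * airyMass l := by
      field_simp
    nlinarith

theorem density_le {l s x : ℝ} (hs : 0 < s) (hsl : s ≤ l) (hx : |x| ≤ l - s) :
    density l x ≤ airyMass s / airyMass l / (2 * s) := by
  have hl : 0 < l := hs.trans_le hsl
  have hP := one_le_airyMass hl.le
  have hr : s ≤ l - |x| := by linarith
  have h1 := airyMass_div_anti hs hr
  have h0 : 0 < l - |x| := hs.trans_le hr
  have h2 : osc (l - |x|) ^ 2 ≤ airyMass (l - |x|) / (l - |x|) := by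
    rw [le_div_iff₀ h0, airyMass_eq]
    nlinarith [sq_nonneg (oscDeriv (l - |x|))]
  rw [density_eq]
  calc osc (l - |x|) ^ 2 / (2 * airyMass l) ≤ (airyMass s / s) / (2 * airyMass l) := by
        gcongr; exact h2.trans h1
    _ = _ := by field_simp

theorem measurable_phaseSin : Measurable phaseSin := by
  have h1 : Continuous osc := continuous_iff_continuousAt.2 fun s => (hasDerivAt_osc s).continuousAt
  have h2 : Continuous airyMass :=
    continuous_iff_continuousAt.2 fun s => (hasDerivAt_airyMass s).continuousAt
  exact (measurable_id.mul (h1.measurable.pow_const 2)).div h2.measurable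

theorem volume_phaseSin_abs_lt (δ : ℝ) (hδ : 0 < δ) : ∃ ε : ℝ, 0 < ε ∧ ∃ C : ℝ, ∀ l, 1 ≤ l →
    volume.real {x | x ∈ Set.Icc (-l) l ∧ phaseSin (l - |x|) < ε} ≤ δ * l + C := by
  obtain ⟨ε, hε, C, hC⟩ := volume_phaseSin_lt (δ / 2) (by positivity)
  refine ⟨ε, hε, 2 * C, fun l hl => ?_⟩
  set Z := {s | s ∈ Set.Icc 0 l ∧ phaseSin s < ε} with hZ
  have hZm : MeasurableSet Z :=
    measurableSet_Icc.inter (measurableSet_lt measurable_phaseSin measurable_const)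
  have hZfin : volume Z ≠ ⊤ :=
    ne_top_of_le_ne_top isCompact_Icc.measure_lt_top.ne
      (measure_mono (fun s hs => hs.1 : Z ⊆ Set.Icc 0 l))
  have h1 : volume ((fun x => l - x) ⁻¹' Z) = volume Z :=
    (Measure.measurePreserving_sub_left volume l).measure_preimage hZm.nullMeasurableSet
  have h2 : volume ((fun x => l + x) ⁻¹' Z) = volume Z := measure_preimage_add volume l Z
  have hsub : {x | x ∈ Set.Icc (-l) l ∧ phaseSin (l - |x|) < ε} ⊆
      (fun x => l - x) ⁻¹' Z ∪ (fun x => l + x) ⁻¹' Z := by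
    rintro x ⟨⟨hx1, hx2⟩, hx⟩
    rcases le_total 0 x with h | h
    · rw [abs_of_nonneg h] at hx
      exact Or.inl ⟨⟨by linarith, by linarith⟩, hx⟩
    · rw [abs_of_nonpos h, sub_neg_eq_add] at hx
      exact Or.inr ⟨⟨by linarith, by linarith⟩, hx⟩
  have h3 := (measureReal_mono hsub (by
    exact (measure_union_lt_top (h1 ▸ hZfin.lt_top) (h2 ▸ hZfin.lt_top)).ne)).trans
      (measureReal_union_le _ _)
  rw [measureReal_def volume ((fun x => l - x) ⁻¹' Z), h1,
    measureReal_def volume ((fun x => l + x) ⁻¹' Z), h2, ← measureReal_def] at h3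
  have h4 := hC l hl
  linarith

/-- Eigenstates of high energy charge every set that fills a fixed proportion of the classically
allowed region. -/
theorem le_setIntegral_density {γ : ℝ} (hγ : 0 < γ) : ∃ D : ℝ, 0 < D ∧ ∃ X : ℝ, ∀ l, X ≤ l →
    ∀ E : Set ℝ, MeasurableSet E → γ * l ≤ volume.real (E ∩ Set.Icc (-l) l) →
      D ≤ ∫ x in E, density l x := by
  obtain ⟨ε, hε, C, hC⟩ := volume_phaseSin_abs_lt (γ / 4) (by positivity)
  -- Bad phases occupy at most γl/4 + C ≤ γl/2. At least γl/2 of the set remains, and there the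
  -- density is at least ε/(2l).
  refine ⟨ε / 2 * (γ / 2), by positivity, max 1 (4 * C / γ), fun l hl E hE hEl => ?_⟩
  have hl1 : 1 ≤ l := (le_max_left _ _).trans hl
  have hl0 : 0 < l := by linarith
  have hlC : 4 * C ≤ l * γ := (div_le_iff₀ hγ).1 ((le_max_right _ _).trans hl)
  set Z := {x | x ∈ Set.Icc (-l) l ∧ phaseSin (l - |x|) < ε} with hZ
  have hZm : MeasurableSet Z := measurableSet_Icc.inter
    (measurableSet_lt (measurable_phaseSin.comp (measurable_const.sub measurable_id.abs))
      measurable_const)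
  have hZfin : volume Z ≠ ⊤ :=
    ne_top_of_le_ne_top isCompact_Icc.measure_lt_top.ne
      (measure_mono (fun s hs => hs.1 : Z ⊆ Set.Icc (-l) l))
  set S := (E ∩ Set.Icc (-l) l) \ Z with hS
  have hSm : MeasurableSet S := (hE.inter measurableSet_Icc).diff hZm
  have hSfin : volume S ≠ ⊤ :=
    ne_top_of_le_ne_top isCompact_Icc.measure_lt_top.ne
      (measure_mono (fun s hs => hs.1.2 : S ⊆ Set.Icc (-l) l))
  have h1 : γ * l ≤ volume.real S + volume.real Z := by
    refine hEl.trans ((measureReal_mono (fun x hx => ?_)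
      (measure_union_lt_top hSfin.lt_top hZfin.lt_top).ne).trans (measureReal_union_le _ _))
    by_cases hxZ : x ∈ Z
    · exact Or.inr hxZ
    · exact Or.inl ⟨hx, hxZ⟩
  have h2 := hC l hl1
  have h3 : γ * l / 2 ≤ volume.real S := by linarith
  have h4 : ∫ _ in S, ε / (2 * l) ≤ ∫ x in S, density l x := by
    refine setIntegral_mono_on (integrableOn_const hSfin) (integrable_density l).integrableOn hSm
      fun x hx => ?_
    have hx1 : |x| ≤ l := abs_le.2 hx.1.2
    have hx2 : ε ≤ phaseSin (l - |x|) := by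
      by_contra! h
      exact hx.2 ⟨hx.1.2, h⟩
    exact le_trans (by gcongr) (phaseSin_le_density hl0 hx1)
  have h5 : ∫ x in S, density l x ≤ ∫ x in E, density l x :=
    setIntegral_mono_set (integrable_density l).integrableOn
      (Eventually.of_forall fun x => density_nonneg hl0.le x)
      (Eventually.of_forall fun x hx => hx.1.1)
  rw [setIntegral_const, smul_eq_mul] at h4
  refine le_trans ?_ (h4.trans h5)
  calc ε / 2 * (γ / 2) = γ * l / 2 * (ε / (2 * l)) := by field_simp
    _ ≤ _ := by gcongr

/-- The set is cut at |x| = l - s: the outer part gets the whole tail mass, the inner part the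
supremum of the density times its measure. -/
theorem setIntegral_density_le {l s : ℝ} (hs : 0 < s) (hsl : s ≤ l) {E : Set ℝ}
    (hE : MeasurableSet E) : ∫ x in E, density l x ≤
      airyMass s / airyMass l * (1 + volume.real (E ∩ Set.Icc (-l) l) / (2 * s)) := by
  have hl : 0 < l := hs.trans_le hsl
  have hP := one_le_airyMass hl.le
  have hPs := one_le_airyMass hs.le
  set T := {x : ℝ | l - s < |x|} with hT
  have hTm : MeasurableSet T := measurableSet_lt measurable_const measurable_id.abs
  have hfin : volume (E ∩ Set.Icc (-l) l) ≠ ⊤ :=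
    ne_top_of_le_ne_top isCompact_Icc.measure_lt_top.ne (measure_mono Set.inter_subset_right)
  have hsub : E \ T ⊆ E ∩ Set.Icc (-l) l := fun x hx =>
    ⟨hx.1, abs_le.1 (le_trans (not_lt.1 hx.2) (by linarith))⟩
  have hfin' : volume (E \ T) ≠ ⊤ := ne_top_of_le_ne_top hfin (measure_mono hsub)
  have h1 : ∫ x in E ∩ T, density l x ≤ airyMass s / airyMass l := by
    rw [← setIntegral_density_tail hl.le hsl]
    exact setIntegral_mono_set (integrable_density l).integrableOn
      (Eventually.of_forall fun x => density_nonneg hl.le x)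
      (Eventually.of_forall fun x hx => hx.2)
  have h2 : ∫ x in E \ T, density l x ≤
      volume.real (E ∩ Set.Icc (-l) l) * (airyMass s / airyMass l / (2 * s)) := by
    calc ∫ x in E \ T, density l x ≤ ∫ _ in E \ T, airyMass s / airyMass l / (2 * s) :=
          setIntegral_mono_on (integrable_density l).integrableOn (integrableOn_const hfin')
            (hE.diff hTm) fun x hx => density_le hs hsl (not_lt.1 hx.2)
      _ = volume.real (E \ T) * (airyMass s / airyMass l / (2 * s)) := by
          rw [setIntegral_const, smul_eq_mul]
      _ ≤ _ := by
          gcongr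
  rw [← integral_inter_add_sdiff hTm (integrable_density l).integrableOn]
  calc _ ≤ _ := add_le_add h1 h2
    _ = _ := by field_simp

/-- If an eigenstate of high energy charges a set, then the set fills a fixed proportion of the
classically allowed region. -/
theorem volume_ge_of_le_setIntegral_density {D : ℝ} (hD : 0 < D) : ∃ η : ℝ, 0 < η ∧ ∃ X : ℝ,
    ∀ l, X ≤ l → ∀ E : Set ℝ, MeasurableSet E → D ≤ ∫ x in E, density l x →
      η * l ≤ volume.real (E ∩ Set.Icc (-l) l) := by
  -- With s = ηl, the growth estimate bounds the squared tail mass by exp (3/2) η ≤ (D/2)². The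
  -- outer layer then takes at most half of D, and the rest needs measure at least 2ηl. The
  -- threshold 1/η ensures s ≥ 1, as the growth estimate requires.
  set η := min 1 (Real.exp (-(3 / 2)) * (D / 2) ^ 2) with hη
  have hη0 : 0 < η := lt_min one_pos (by positivity)
  refine ⟨2 * η, by positivity, 1 / η, fun l hl E hE hDE => ?_⟩
  have hl1 : 1 ≤ η * l := by rwa [div_le_iff₀' hη0] at hl
  have hl0 : 0 < l := by
    by_contra! h
    nlinarith
  have hsl : η * l ≤ l := by nlinarith [min_le_left 1 (Real.exp (-(3 / 2)) * (D / 2) ^ 2)]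
  have hs0 : 0 < η * l := by positivity
  have h1 := setIntegral_density_le hs0 hsl hE
  have h2 := airyMass_growth hl1 hsl
  have hP := one_le_airyMass hl0.le
  have hPs := one_le_airyMass hs0.le
  set m := volume.real (E ∩ Set.Icc (-l) l)
  have h3 : airyMass (η * l) / airyMass l ≤ D / 2 := by
    refine le_of_sq_le_sq ?_ (by positivity)
    have h4 : (airyMass (η * l) / airyMass l) ^ 2 ≤ Real.exp (3 / 2) * η := by
      rw [div_le_iff₀ hs0] at h2
      rw [div_pow, div_le_iff₀ (by positivity)]
      refine h2.trans (le_of_eq ?_)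
      field_simp
    refine h4.trans ?_
    calc Real.exp (3 / 2) * η ≤ Real.exp (3 / 2) * (Real.exp (-(3 / 2)) * (D / 2) ^ 2) := by
          gcongr; exact min_le_right _ _
      _ = (D / 2) ^ 2 := by rw [← mul_assoc, ← Real.exp_add]; simp
  have h5 : 0 ≤ m / (2 * (η * l)) := div_nonneg measureReal_nonneg (by positivity)
  have h6 : D ≤ D / 2 * (1 + m / (2 * (η * l))) :=
    hDE.trans (h1.trans (by gcongr))
  have h7 : 1 ≤ m / (2 * (η * l)) := by
    by_contra! h
    nlinarith
  rw [le_div_iff₀ (by positivity)] at h7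
  linarith

/-- The zeros of the density come from zeros of `osc`, hence are countable and null. This takes care
of the finitely many low energies. -/
theorem setIntegral_density_pos {l : ℝ} (hl : 0 ≤ l) {E : Set ℝ} (hE : volume E ≠ 0) :
    0 < ∫ x in E, density l x := by
  have hP := one_le_airyMass hl
  rw [setIntegral_pos_iff_support_of_nonneg_ae
    (Eventually.of_forall fun x => density_nonneg hl x) (integrable_density l).integrableOn]
  have hc : {x | density l x = 0}.Countable := by
    have h : {x | density l x = 0} ⊆
        (fun s => l - s) '' oscZeros ∪ (fun s => s - l) '' oscZeros := by
      intro x hx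
      have h1 : osc (l - |x|) = 0 := by
        have h2 : density l x = 0 := hx
        rw [density_eq, div_eq_zero_iff] at h2
        rcases h2 with h2 | h2
        · exact pow_eq_zero_iff two_ne_zero |>.1 h2
        · linarith
      rcases le_total 0 x with h | h
      · exact Or.inl ⟨l - |x|, Or.inl h1, by simp [abs_of_nonneg h]⟩
      · exact Or.inr ⟨l - |x|, Or.inl h1, by simp [abs_of_nonpos h]⟩
    exact ((countable_oscZeros.image _).union (countable_oscZeros.image _)).mono h
  have h0 := hc.measure_zero volume
  refine pos_iff_ne_zero.2 fun h => hE (measure_mono_null (fun x hx => ?_)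
    (measure_union_null h h0))
  by_cases h1 : density l x = 0
  · exact Or.inr h1
  · exact Or.inl ⟨h1, hx⟩

/-! ### Mollification and C² test functions -/

/-- A shrinking sequence of smooth bumps around `0`. -/
noncomputable def shrinkingBump (n : ℕ) : ContDiffBump (0 : ℝ) where
  rIn := 1 / (2 * (n + 1))
  rOut := 1 / (n + 1)
  rIn_pos := by positivity
  rIn_lt_rOut := by
    refine one_div_lt_one_div_of_lt (by positivity) ?_
    linarith [(by positivity : (0 : ℝ) < n + 1)]

theorem shrinkingBump_rOut_le (n : ℕ) : (shrinkingBump n).rOut ≤ 1 := by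
  refine (div_le_one (by positivity)).2 ?_
  linarith [(by positivity : (0 : ℝ) ≤ n)]

/-- The mollification of a function. -/
noncomputable def mollify (n : ℕ) (k : ℝ → ℝ) : ℝ → ℝ :=
  convolution ((shrinkingBump n).normed volume) k (ContinuousLinearMap.lsmul ℝ ℝ) volume

theorem hasCompactSupport_of_vanishing {k : ℝ → ℝ} {T : ℝ} (h : ∀ x, T < |x| → k x = 0) :
    HasCompactSupport k :=
  HasCompactSupport.intro (isCompact_Icc (a := -T) (b := T)) fun x hx =>
    h x (by rw [lt_abs]; by_contra! hc; exact hx ⟨by linarith [hc.2], hc.1⟩)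

theorem contDiff_mollify (n : ℕ) {k : ℝ → ℝ} (hk : Continuous k) : ContDiff ℝ ∞ (mollify n k) :=
  (shrinkingBump n).hasCompactSupport_normed.contDiff_convolution_left _
    (shrinkingBump n).contDiff_normed hk.locallyIntegrable

theorem hasDerivAt_mollify (n : ℕ) {k k' : ℝ → ℝ} (hc : HasCompactSupport k)
    (hk : ∀ x, HasDerivAt k (k' x) x) (hk' : Continuous k') (x : ℝ) :
    HasDerivAt (mollify n k) (mollify n k' x) x := by
  have hd : deriv k = k' := funext fun x => (hk x).deriv
  have h1 : ContDiff ℝ 1 k :=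
    contDiff_one_iff_deriv.2 ⟨fun x => (hk x).differentiableAt, hd ▸ hk'⟩
  have := hc.hasDerivAt_convolution_right (μ := volume) (ContinuousLinearMap.lsmul ℝ ℝ)
    (f₀ := (shrinkingBump n).normed volume)
    (shrinkingBump n).continuous_normed.locallyIntegrable h1 x
  rwa [hd] at this

theorem mollify_eq_zero (n : ℕ) {k : ℝ → ℝ} {T : ℝ} (h : ∀ x, T < |x| → k x = 0) (x : ℝ)
    (hx : T + 1 < |x|) : mollify n k x = 0 := by
  have h0 : k x = 0 := h x (by linarith)
  rw [← h0]
  refine (shrinkingBump n).normed_convolution_eq_right fun y hy => ?_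
  rw [h0]
  refine h y ?_
  have h1 : |y - x| < 1 := (Metric.mem_ball.1 hy).trans_le (shrinkingBump_rOut_le n)
  have h2 := abs_sub_abs_le_abs_sub x y
  rw [abs_sub_comm] at h2
  linarith

/-- The crude factor 3 comes from the oscillation bound 2C plus the value itself; any bound uniform
in n serves for dominated convergence. -/
theorem abs_mollify_le (n : ℕ) {k : ℝ → ℝ} {C : ℝ} (hk : Continuous k) (h : ∀ x, |k x| ≤ C)
    (x : ℝ) : |mollify n k x| ≤ 3 * C := by
  have h1 : dist (mollify n k x) (k x) ≤ 2 * C :=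
    (shrinkingBump n).dist_normed_convolution_le hk.aestronglyMeasurable fun y _ => by
      rw [Real.dist_eq]
      linarith [abs_sub (k y) (k x), h x, h y]
  rw [Real.dist_eq] at h1
  have h2 := abs_sub_abs_le_abs_sub (mollify n k x) (k x)
  linarith [h x]

theorem tendsto_mollify {k : ℝ → ℝ} (hk : Continuous k) (x : ℝ) :
    Tendsto (fun n => mollify n k x) atTop (nhds (k x)) :=
  ContDiffBump.convolution_tendsto_right_of_continuous
    tendsto_one_div_add_atTop_nhds_zero_nat hk x

theorem tendsto_integral_mollify {k : ℝ → ℝ} (hk : Continuous k) {T : ℝ}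
    (hT : ∀ x, T < |x| → k x = 0) {w : ℝ → ℂ} (hw : LocallyIntegrable w) :
    Tendsto (fun n => ∫ x, mollify n k x • w x) atTop (nhds (∫ x, k x • w x)) := by
  obtain ⟨C, hC⟩ := (hasCompactSupport_of_vanishing hT).exists_bound_of_continuous hk
  have hC0 : 0 ≤ C := (norm_nonneg _).trans (hC 0)
  refine tendsto_integral_of_dominated_convergence
    ((Set.Icc (-(T + 1)) (T + 1)).indicator fun x => 3 * C * ‖w x‖)
    (fun n => (contDiff_mollify n hk).continuous.aestronglyMeasurable.smul
      hw.aestronglyMeasurable) ?_ (fun n => Eventually.of_forall fun x => ?_)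
    (Eventually.of_forall fun x => (tendsto_mollify hk x).smul_const _)
  · rw [integrable_indicator_iff measurableSet_Icc]
    exact ((hw.integrableOn_isCompact isCompact_Icc).norm).const_mul _
  · rw [norm_smul]
    by_cases hx : x ∈ Set.Icc (-(T + 1)) (T + 1)
    · rw [Set.indicator_of_mem hx]
      gcongr
      exact abs_mollify_le n hk hC x
    · rw [Set.indicator_of_notMem hx, mollify_eq_zero n hT x, norm_zero, zero_mul]
      rw [lt_abs]; by_contra! hc; exact hx ⟨by linarith [hc.2], hc.1⟩

/-- The eigenvalue equation may be tested with compactly supported functions of class `C²`. -/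
theorem HasImage.integral_eq_zero {lam : ℝ} {u : ℝ → ℂ}
    (hu : HasImage u (fun x => (lam : ℂ) * u x)) {k k' k'' : ℝ → ℝ} {T : ℝ}
    (hT : ∀ x, T < |x| → k x = 0) (hk : ∀ x, HasDerivAt k (k' x) x)
    (hk' : ∀ x, HasDerivAt k' (k'' x) x) (hk'' : Continuous k'') :
    ∫ x, (-k'' x + (|x| - lam) * k x) • u x = 0 := by
  obtain ⟨hu2, -, hu3⟩ := hu
  have hloc : LocallyIntegrable u := hu2.locallyIntegrable (by norm_num)
  have hkc : Continuous k := continuous_iff_continuousAt.2 fun x => (hk x).continuousAt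
  have hkc' : Continuous k' := continuous_iff_continuousAt.2 fun x => (hk' x).continuousAt
  have hcs := hasCompactSupport_of_vanishing hT
  have hd : deriv k = k' := funext fun x => (hk x).deriv
  have hd' : deriv k' = k'' := funext fun x => (hk' x).deriv
  have hcs' : HasCompactSupport k' := hd ▸ hcs.deriv
  have hT' : ∀ x, T < |x| → k' x = 0 ∧ k'' x = 0 := by
    have hstep : ∀ f : ℝ → ℝ, (∀ x, T < |x| → f x = 0) → ∀ x, T < |x| → deriv f x = 0 := by
      intro f hf x hx
      have : f =ᶠ[nhds x] fun _ => 0 := by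
        filter_upwards [continuous_abs.continuousAt.eventually (lt_mem_nhds hx)] with y hy
        exact hf y hy
      rw [this.deriv_eq, deriv_const]
    have h1 : ∀ x, T < |x| → k' x = 0 := hd ▸ hstep k hT
    exact fun x hx => ⟨h1 x hx, (hd' ▸ hstep k' h1) x hx⟩
  have hwloc : LocallyIntegrable fun x => (|x| - lam) • u x :=
    hloc.continuous_smul (by fun_prop)
  have hint : ∀ {f : ℝ → ℝ} {w : ℝ → ℂ}, Continuous f → (∃ S, ∀ x, S < |x| → f x = 0) →
      LocallyIntegrable w → Integrable fun x => f x • w x := fun hf ⟨S, hS⟩ hw =>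
    hw.integrable_smul_left_of_hasCompactSupport hf (hasCompactSupport_of_vanishing hS)
  have hsplit : ∀ {f g : ℝ → ℝ}, Continuous f → Continuous g →
      (∃ S, ∀ x, S < |x| → f x = 0) → (∃ S, ∀ x, S < |x| → g x = 0) →
      ∫ x, (-g x + (|x| - lam) * f x) • u x =
        -(∫ x, g x • u x) + ∫ x, f x • ((|x| - lam) • u x) := fun {f g} hf hg hf0 hg0 => by
    rw [← integral_neg, ← integral_add (f := fun x => -(g x • u x)) (hint hg hg0 hloc).neg (hint hf hf0 hwloc)]
    refine integral_congr_ae (Eventually.of_forall fun x => ?_)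
    simp only [Complex.real_smul]
    push_cast
    ring
  -- Mollification commutes with differentiation, so mollified C² functions are admissible in the
  -- definition of the operator. The identity then passes to the limit against locally integrable
  -- functions.
  have hzero : ∀ n, -(∫ x, mollify n k'' x • u x) +
      ∫ x, mollify n k x • ((|x| - lam) • u x) = 0 := fun n => by
    have hm0 : ∃ S, ∀ x, S < |x| → mollify n k x = 0 := ⟨T + 1, mollify_eq_zero n hT⟩
    have hm0'' : ∃ S, ∀ x, S < |x| → mollify n k'' x = 0 :=
      ⟨T + 1, mollify_eq_zero n fun x hx => (hT' x hx).2⟩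
    have hmc := (contDiff_mollify n hkc).continuous
    have hmc'' := (contDiff_mollify n hk'').continuous
    have h := hu3 (mollify n k) (contDiff_mollify n hkc)
      (hasCompactSupport_of_vanishing hm0.choose_spec)
    rw [funext fun x => (hasDerivAt_mollify n hcs hk hkc' x).deriv,
      funext fun x => (hasDerivAt_mollify n hcs' hk' hk'' x).deriv] at h
    rw [← hsplit hmc hmc'' hm0 hm0'', ← sub_eq_zero.2 h, ← integral_sub]
    · refine integral_congr_ae (Eventually.of_forall fun x => ?_)
      simp only [Complex.real_smul]
      push_cast
      ring
    · refine hint (by fun_prop) ?_ hloc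
      exact ⟨T + 1, fun x hx => by
        rw [mollify_eq_zero n hT x hx, mollify_eq_zero n (fun x hx => (hT' x hx).2) x hx]; simp⟩
    · exact hint hmc hm0 (hloc.smul (lam : ℂ))
  rw [hsplit hkc hk'' ⟨T, hT⟩ ⟨T, fun x hx => (hT' x hx).2⟩]
  have hlim := (tendsto_integral_mollify hk'' (fun x hx => (hT' x hx).2) hloc).neg.add
    (tendsto_integral_mollify hkc hT hwloc)
  exact tendsto_nhds_unique hlim ((tendsto_congr hzero).2 tendsto_const_nhds)

/-! ### Weak solutions are classical -/

theorem hasDerivAt_smoothTransition (x : ℝ) :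
    HasDerivAt Real.smoothTransition (deriv Real.smoothTransition x) x :=
  ((Real.smoothTransition.contDiff (n := 1)).differentiable one_ne_zero x).hasDerivAt

theorem contDiff_deriv_smoothTransition : ContDiff ℝ 1 (deriv Real.smoothTransition) :=
  ((contDiff_succ_iff_deriv (n := 1)).1
    (Real.smoothTransition.contDiff (n := 1 + 1))).2.2

theorem hasDerivAt_deriv_smoothTransition (x : ℝ) :
    HasDerivAt (deriv Real.smoothTransition) (deriv (deriv Real.smoothTransition) x) x :=
  (contDiff_deriv_smoothTransition.differentiable one_ne_zero x).hasDerivAt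

theorem continuous_deriv_deriv_smoothTransition :
    Continuous (deriv (deriv Real.smoothTransition)) :=
  contDiff_deriv_smoothTransition.continuous_deriv le_rfl

/-- The density obtained by applying the operator to a solution times a smooth transition. -/
noncomputable def transitionSource (y y' : ℝ → ℝ) (x : ℝ) : ℝ :=
  deriv (deriv Real.smoothTransition) x * y x + 2 * deriv Real.smoothTransition x * y' x

theorem deriv_smoothTransition_eq_zero {x : ℝ} (hx : 1 < |x|) :
    deriv Real.smoothTransition x = 0 ∧ deriv (deriv Real.smoothTransition) x = 0 := by
  have h : ∃ c, Real.smoothTransition =ᶠ[nhds x] fun _ => c := by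
    rcases lt_abs.1 hx with h | h
    · exact ⟨1, by filter_upwards [lt_mem_nhds h] with y hy
                   exact Real.smoothTransition.one_of_one_le hy.le⟩
    · refine ⟨0, ?_⟩
      filter_upwards [gt_mem_nhds (show x < 0 by linarith)] with y hy
      exact Real.smoothTransition.zero_of_nonpos hy.le
  obtain ⟨c, hc⟩ := h
  have h1 := hc.deriv
  simp only [deriv_const'] at h1
  have h2 := h1.deriv
  simp only [deriv_const'] at h2
  exact ⟨h1.eq_of_nhds, h2.eq_of_nhds⟩

theorem integral_partial_eq {h : ℝ → ℝ} {T : ℝ} (hT : ∀ x, T < |x| → h x = 0)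
    {x : ℝ} (hx : T + 1 < |x|) :
    ∫ t in (-(T + 1))..x, h t = if 0 < x then ∫ t, h t else 0 := by
  split_ifs with h0
  · rw [abs_of_pos h0] at hx
    refine intervalIntegral.integral_eq_integral_of_support_subset fun t ht => ?_
    by_contra hc
    refine ht (hT t ?_)
    rw [lt_abs]
    by_contra! h1
    exact hc ⟨by linarith [h1.2], by linarith [h1.1]⟩
  · rw [abs_of_nonpos (not_lt.1 h0)] at hx
    rw [intervalIntegral.integral_congr (g := fun _ => 0), intervalIntegral.integral_zero]
    intro t ht
    refine hT t ?_
    rw [Set.uIcc_of_ge (by linarith)] at ht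
    rw [lt_abs]
    exact Or.inr (by linarith [ht.2])

/-- A weak solution of the eigenvalue equation is a combination of two classical solutions. -/
theorem HasImage.ae_eq_combination {lam : ℝ} {u : ℝ → ℂ}
    (hu : HasImage u (fun x => (lam : ℂ) * u x)) {y y' z z' : ℝ → ℝ}
    (hy : ∀ x, HasDerivAt y (y' x) x) (hy' : ∀ x, HasDerivAt y' ((|x| - lam) * y x) x)
    (hz : ∀ x, HasDerivAt z (z' x) x) (hz' : ∀ x, HasDerivAt z' ((|x| - lam) * z x) x)
    (hW : ∀ x, y x * z' x - y' x * z x = 1) :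
    ∃ a b : ℂ, u =ᵐ[volume] fun x => a * y x + b * z x := by
  have cont : ∀ {f f' : ℝ → ℝ}, (∀ x, HasDerivAt f (f' x) x) → Continuous f := fun h =>
    continuous_iff_continuousAt.2 fun x => (h x).continuousAt
  have cy := cont hy
  have cz := cont hz
  have cy' := cont hy'
  have cz' := cont hz'
  have cθ' := cont hasDerivAt_deriv_smoothTransition
  have cθ'' := continuous_deriv_deriv_smoothTransition
  have hloc : LocallyIntegrable u := hu.1.locallyIntegrable (by norm_num)
  have hint : ∀ {f : ℝ → ℝ} {S : ℝ}, Continuous f → (∀ x, S < |x| → f x = 0) →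
      Integrable fun x => f x • u x := fun hf hS =>
    hloc.integrable_smul_left_of_hasCompactSupport hf (hasCompactSupport_of_vanishing hS)
  have hsrc : ∀ (w w' : ℝ → ℝ) (x : ℝ), 1 < |x| → transitionSource w w' x = 0 := by
    intro w w' x hx
    obtain ⟨h1, h2⟩ := deriv_smoothTransition_eq_zero hx
    rw [transitionSource, h1, h2]; ring
  have csrc : ∀ {w w' : ℝ → ℝ}, Continuous w → Continuous w' →
      Continuous (transitionSource w w') := fun hw hw' =>
    (cθ''.mul hw).add ((continuous_const.mul cθ').mul hw')
  set A := ∫ x, transitionSource y y' x • u x with hA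
  set B := ∫ x, transitionSource z z' x • u x with hB
  refine ⟨B, -A, ae_eq_of_integral_contDiff_smul_eq hloc ?_ fun h hh hcs => ?_⟩
  · exact Continuous.locallyIntegrable (by fun_prop)
  have ch := hh.continuous
  obtain ⟨T, hT1, hT⟩ : ∃ T : ℝ, 1 ≤ T ∧ ∀ x, T < |x| → h x = 0 := by
    obtain ⟨R, hR⟩ := hcs.isCompact.isBounded.subset_closedBall 0
    refine ⟨max 1 R, le_max_left _ _, fun x hx => image_eq_zero_of_notMem_tsupport fun hc => ?_⟩
    have := mem_closedBall_zero_iff.1 (hR hc)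
    rw [Real.norm_eq_abs] at this
    linarith [le_max_right 1 R]
  -- Variation of parameters for the source h is truncated by subtracting c and d times the smooth
  -- transition. These total integrals make `J` and `K` vanish outside a compact set, so z J - y K
  -- is an admissible test function. The cutoff leaves source terms with coefficients c and d, whose
  -- pairings with u are the constants `B` and `A`.
  set c := -∫ t, y t * h t with hc
  set d := -∫ t, z t * h t with hd
  set J : ℝ → ℝ := fun x => (-∫ t in (-(T + 1))..x, y t * h t) - c * Real.smoothTransition x
    with hJ
  set K : ℝ → ℝ := fun x => (-∫ t in (-(T + 1))..x, z t * h t) - d * Real.smoothTransition x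
    with hK
  have hdJ : ∀ x, HasDerivAt J (-(y x * h x) - c * deriv Real.smoothTransition x) x := fun x =>
    ((cy.mul ch).integral_hasStrictDerivAt _ x).hasDerivAt.neg.sub
      ((hasDerivAt_smoothTransition x).const_mul c)
  have hdK : ∀ x, HasDerivAt K (-(z x * h x) - d * deriv Real.smoothTransition x) x := fun x =>
    ((cz.mul ch).integral_hasStrictDerivAt _ x).hasDerivAt.neg.sub
      ((hasDerivAt_smoothTransition x).const_mul d)
  have hvan : ∀ (w : ℝ → ℝ), Continuous w → ∀ x, T + 1 < |x| →
      (-∫ t in (-(T + 1))..x, w t * h t) - (-∫ t, w t * h t) * Real.smoothTransition x = 0 := by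
    intro w hw x hx
    rw [integral_partial_eq (h := fun t => w t * h t) (T := T)
      (fun t ht => by rw [hT t ht, mul_zero]) hx]
    split_ifs with h0
    · rw [abs_of_pos h0] at hx
      rw [Real.smoothTransition.one_of_one_le (by linarith)]; ring
    · rw [Real.smoothTransition.zero_of_nonpos (not_lt.1 h0)]; ring
  have key := hu.integral_eq_zero (T := T + 1)
    (k := fun x => z x * J x - y x * K x)
    (k' := fun x => z' x * J x - y' x * K x - c * (deriv Real.smoothTransition x * z x)
      + d * (deriv Real.smoothTransition x * y x))
    (k'' := fun x => (|x| - lam) * (z x * J x - y x * K x) - h x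
      - c * transitionSource z z' x + d * transitionSource y y' x)
    (fun x hx => by
      have h1 : J x = 0 := hvan y cy x hx
      have h2 : K x = 0 := hvan z cz x hx
      simp only [h1, h2]; ring)
    (fun x => by
      refine (((hz x).mul (hdJ x)).sub ((hy x).mul (hdK x))).congr_deriv ?_
      ring)
    (fun x => by
      refine (((((hz' x).mul (hdJ x)).sub ((hy' x).mul (hdK x))).sub
        (((hasDerivAt_deriv_smoothTransition x).mul (hz x)).const_mul c)).add
        (((hasDerivAt_deriv_smoothTransition x).mul (hy x)).const_mul d)).congr_deriv ?_
      have := hW x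
      simp only [transitionSource]
      linear_combination (-h x) * this)
    (by
      have cJ := cont hdJ
      have cK := cont hdK
      have := csrc cy cy'
      have := csrc cz cz'
      fun_prop)
  have hsum : ∫ x, (-((|x| - lam) * (z x * J x - y x * K x) - h x
      - c * transitionSource z z' x + d * transitionSource y y' x)
      + (|x| - lam) * (z x * J x - y x * K x)) • u x =
      (∫ x, h x • u x) + ((c : ℂ) * B - (d : ℂ) * A) := by
    rw [hA, hB, ← integral_const_mul, ← integral_const_mul, ← integral_sub, ← integral_add]
    · refine integral_congr_ae (Eventually.of_forall fun x => ?_)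
      simp only [Complex.real_smul]
      push_cast
      ring
    · exact hint ch hT
    · exact ((hint (csrc cz cz') (hsrc z z')).const_mul _).sub
        ((hint (csrc cy cy') (hsrc y y')).const_mul _)
    · exact (hint (csrc cz cz') (hsrc z z')).const_mul _
    · exact (hint (csrc cy cy') (hsrc y y')).const_mul _
  rw [hsum] at key
  have hcomb : ∫ x, h x • (B * (y x : ℂ) + -A * (z x : ℂ)) = -(c : ℂ) * B + (d : ℂ) * A := by
    have hi : ∀ {w : ℝ → ℝ}, Continuous w → Integrable fun x => ((w x * h x : ℝ) : ℂ) :=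
      fun {w} hw => ((hw.mul ch).integrable_of_hasCompactSupport
        (hasCompactSupport_of_vanishing (T := T) fun x hx => by
          simp [hT x hx])).ofReal
    have h1 : (c : ℂ) = -∫ x, ((y x * h x : ℝ) : ℂ) := by
      rw [hc, integral_complex_ofReal]; push_cast; rfl
    have h2 : (d : ℂ) = -∫ x, ((z x * h x : ℝ) : ℂ) := by
      rw [hd, integral_complex_ofReal]; push_cast; rfl
    rw [h1, h2, neg_neg, neg_mul, ← sub_eq_add_neg, ← integral_mul_const, ← integral_mul_const,
      ← integral_sub ((hi cy).mul_const _) ((hi cz).mul_const _)]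
    refine integral_congr_ae (Eventually.of_forall fun x => ?_)
    simp only [Complex.real_smul]
    push_cast
    ring
  rw [hcomb]
  linear_combination key

/-! ### Even and odd extensions, construction of eigenfunctions -/

/-- The two one-sided derivatives at 0 are both p'(0), and they glue because p(0) = 0 makes the
extension continuous there. -/
theorem hasDerivAt_oddExtension {p p' : ℝ → ℝ} (hp : ∀ x, HasDerivAt p (p' x) x) (h0 : p 0 = 0)
    (x : ℝ) : HasDerivAt (fun x => Real.sign x * p |x|) (p' |x|) x := by
  have hr : ∀ y : ℝ, 0 ≤ y → Real.sign y * p |y| = p y := fun y hy => by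
    rcases hy.eq_or_lt with rfl | h
    · simp [h0]
    · rw [Real.sign_of_pos h, abs_of_pos h, one_mul]
  have hl : ∀ y : ℝ, y ≤ 0 → Real.sign y * p |y| = -p (-y) := fun y hy => by
    rcases hy.eq_or_lt with rfl | h
    · simp [h0]
    · rw [Real.sign_of_neg h, abs_of_neg h, neg_one_mul]
  have hn : HasDerivAt (fun y => -p (-y)) (p' (-x)) x := by
    refine ((hp (-x)).comp x (hasDerivAt_neg x)).neg.congr_deriv ?_
    ring
  rcases lt_trichotomy x 0 with h | h | h
  · rw [abs_of_neg h]
    refine hn.congr_of_eventuallyEq ?_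
    filter_upwards [gt_mem_nhds h] with y hy using hl y hy.le
  · subst h
    rw [neg_zero] at hn
    rw [abs_zero, ← hasDerivWithinAt_univ, ← Set.Iic_union_Ici (a := (0 : ℝ))]
    exact (hn.hasDerivWithinAt.congr (fun y hy => hl y hy) (hl 0 le_rfl)).union
      ((hp 0).hasDerivWithinAt.congr (fun y hy => hr y hy) (hr 0 le_rfl))
  · rw [abs_of_pos h]
    refine (hp x).congr_of_eventuallyEq ?_
    filter_upwards [lt_mem_nhds h] with y hy using hr y hy.le

theorem hasDerivAt_evenExtension {p p' : ℝ → ℝ} (hp : ∀ x, HasDerivAt p (p' x) x) (h0 : p' 0 = 0)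
    (x : ℝ) : HasDerivAt (fun x => p |x|) (Real.sign x * p' |x|) x := by
  have hn : HasDerivAt (fun y => p (-y)) (-p' (-x)) x := by
    refine ((hp (-x)).comp x (hasDerivAt_neg x)).congr_deriv ?_
    ring
  have hr : ∀ y : ℝ, 0 ≤ y → p |y| = p y := fun y hy => by rw [abs_of_nonneg hy]
  have hl : ∀ y : ℝ, y ≤ 0 → p |y| = p (-y) := fun y hy => by rw [abs_of_nonpos hy]
  rcases lt_trichotomy x 0 with h | h | h
  · rw [abs_of_neg h, Real.sign_of_neg h, neg_one_mul]
    refine hn.congr_of_eventuallyEq ?_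
    filter_upwards [gt_mem_nhds h] with y hy using hl y hy.le
  · subst h
    rw [neg_zero, h0, neg_zero] at hn
    rw [Real.sign_zero, zero_mul, ← hasDerivWithinAt_univ, ← Set.Iic_union_Ici (a := (0 : ℝ))]
    exact (hn.hasDerivWithinAt.congr (fun y hy => hl y hy) (hl 0 le_rfl)).union
      ((h0 ▸ hp 0).hasDerivWithinAt.congr (fun y hy => hr y hy) (hr 0 le_rfl))
  · rw [abs_of_pos h, Real.sign_of_pos h, one_mul]
    refine (hp x).congr_of_eventuallyEq ?_
    filter_upwards [lt_mem_nhds h] with y hy using hr y hy.le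

/-- An even solution on the line from a solution on the half-line with vanishing derivative. -/
theorem hasDerivAt_even_solution {l : ℝ} {p p' : ℝ → ℝ} (hp : ∀ x, HasDerivAt p (p' x) x)
    (hp' : ∀ x, HasDerivAt p' ((x - l) * p x) x) (h0 : p' 0 = 0) :
    (∀ x, HasDerivAt (fun x => p |x|) (Real.sign x * p' |x|) x) ∧
      ∀ x, HasDerivAt (fun x => Real.sign x * p' |x|) ((|x| - l) * p |x|) x :=
  ⟨hasDerivAt_evenExtension hp h0, hasDerivAt_oddExtension hp' h0⟩

/-- An odd solution on the line from a solution on the half-line vanishing at `0`. -/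
theorem hasDerivAt_odd_solution {l : ℝ} {p p' : ℝ → ℝ} (hp : ∀ x, HasDerivAt p (p' x) x)
    (hp' : ∀ x, HasDerivAt p' ((x - l) * p x) x) (h0 : p 0 = 0) :
    (∀ x, HasDerivAt (fun x => Real.sign x * p |x|) (p' |x|) x) ∧
      ∀ x, HasDerivAt (fun x => p' |x|) ((|x| - l) * (Real.sign x * p |x|)) x := by
  refine ⟨hasDerivAt_oddExtension hp h0, fun x => ?_⟩
  refine (hasDerivAt_evenExtension hp' (by simp [h0]) x).congr_deriv ?_
  ring

theorem hasDerivAt_airy_sub (l x : ℝ) :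
    HasDerivAt (fun x => airy (x - l)) (airyDeriv (x - l)) x :=
  (hasDerivAt_airy (x - l)).comp_sub_const x l

theorem hasDerivAt_airyDeriv_sub (l x : ℝ) :
    HasDerivAt (fun x => airyDeriv (x - l)) ((x - l) * airy (x - l)) x :=
  (hasDerivAt_airyDeriv (x - l)).comp_sub_const x l

/-- A classical solution with the modulus of `airy (|x| - l)` is an eigenfunction. -/
theorem isEigenfunction_of_classical {l : ℝ} {y y' : ℝ → ℝ} (hl : 0 ≤ l)
    (hy : ∀ x, HasDerivAt y (y' x) x) (hy' : ∀ x, HasDerivAt y' ((|x| - l) * y x) x)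
    (hsq : ∀ᵐ x, y x ^ 2 = density l x) :
    IsEigenfunction l (fun x => (y x : ℂ)) ∧ ∫ x, ‖(y x : ℂ)‖ ^ 2 = 1 := by
  have hP := one_le_airyMass hl
  have cy : Continuous y := continuous_iff_continuousAt.2 fun x => (hy x).continuousAt
  have cy' : Continuous y' := continuous_iff_continuousAt.2 fun x => (hy' x).continuousAt
  have hnorm : ∀ᵐ x, ‖(y x : ℂ)‖ ^ 2 = density l x := by
    filter_upwards [hsq] with x hx
    rw [Complex.norm_real, Real.norm_eq_abs, sq_abs, hx]
  have hone : ∫ x, ‖(y x : ℂ)‖ ^ 2 = 1 := by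
    rw [integral_congr_ae hnorm]
    simp only [density]
    rw [integral_div, integral_airy_abs_sub_sq, div_self (by positivity)]
  have hm : MemLp (fun x => (y x : ℂ)) 2 volume := by
    rw [memLp_two_iff_integrable_sq_norm (by fun_prop)]
    exact (integrable_density l).congr (hnorm.mono fun x hx => hx.symm)
  refine ⟨⟨⟨hm, hm.const_mul _, fun ψ hψ hcs => ?_⟩, fun h => ?_⟩, hone⟩
  · have hψ1 : ∀ x, HasDerivAt ψ (deriv ψ x) x := fun x =>
      (hψ.differentiable (by simp) x).hasDerivAt
    have hψ' : ContDiff ℝ ∞ (deriv ψ) := (contDiff_infty_iff_deriv.1 hψ).2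
    have hψ2 : ∀ x, HasDerivAt (deriv ψ) (deriv (deriv ψ) x) x := fun x =>
      (hψ'.differentiable (by simp) x).hasDerivAt
    have c0 := hψ.continuous
    have c1 := hψ'.continuous
    have c2 : Continuous (deriv (deriv ψ)) := (contDiff_infty_iff_deriv.1 hψ').2.continuous
    have hz := integral_eq_zero_of_hasDerivAt_of_integrable
      (f := fun x => ψ x * y' x - deriv ψ x * y x)
      (f' := fun x => ψ x * ((|x| - l) * y x) - deriv (deriv ψ) x * y x)
      (fun x => (((hψ1 x).mul (hy' x)).sub ((hψ2 x).mul (hy x))).congr_deriv (by ring))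
      (Continuous.integrable_of_hasCompactSupport (by fun_prop)
        (hcs.mul_right.sub hcs.deriv.deriv.mul_right))
      (Continuous.integrable_of_hasCompactSupport (by fun_prop)
        (hcs.mul_right.sub hcs.deriv.mul_right))
    have i1 : Integrable fun x => (-deriv (deriv ψ) x + |x| * ψ x) * y x :=
      Continuous.integrable_of_hasCompactSupport (by fun_prop)
        ((hcs.deriv.deriv.neg.add hcs.mul_left).mul_right)
    have i2 : Integrable fun x => ψ x * (l * y x) :=
      Continuous.integrable_of_hasCompactSupport (by fun_prop) hcs.mul_right
    have heq : ∫ x, (-deriv (deriv ψ) x + |x| * ψ x) * y x = ∫ x, ψ x * (l * y x) := by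
      rw [← sub_eq_zero, ← integral_sub i1 i2, ← hz]
      congr 1
      ext x
      ring
    calc ∫ x, (-deriv (deriv ψ) x + |x| * ψ x) • (y x : ℂ)
        = ∫ x, (((-deriv (deriv ψ) x + |x| * ψ x) * y x : ℝ) : ℂ) := by
          congr 1; ext x; rw [Complex.real_smul]; push_cast; ring
      _ = ∫ x, ((ψ x * (l * y x) : ℝ) : ℂ) := by
          rw [integral_complex_ofReal, integral_complex_ofReal, heq]
      _ = _ := by congr 1; ext x; rw [Complex.real_smul]; push_cast; ring
  · have h2 : ∫ x, ‖(y x : ℂ)‖ ^ 2 = 0 := by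
      rw [integral_congr_ae (g := fun _ => 0), integral_zero]
      filter_upwards [h] with x hx
      simp [hx]
    linarith

theorem exists_normalized_eigenfunction {l : ℝ} (hl : l ∈ oscZeros) :
    ∃ u : ℝ → ℂ, IsEigenfunction l u ∧ ∫ x, ‖u x‖ ^ 2 = 1 := by
  have hl0 := oscZeros_pos hl
  have hP := one_le_airyMass hl0.le
  set c := (Real.sqrt (2 * airyMass l))⁻¹ with hc
  have hc2 : c ^ 2 = 1 / (2 * airyMass l) := by
    rw [hc, inv_pow, Real.sq_sqrt (by positivity), one_div]
  have hsolve : ∀ x, HasDerivAt (fun x => c * airy (x - l)) (c * airyDeriv (x - l)) x := fun x =>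
    (hasDerivAt_airy_sub l x).const_mul c
  have hsolve' : ∀ x, HasDerivAt (fun x => c * airyDeriv (x - l))
      ((x - l) * (c * airy (x - l))) x := fun x =>
    ((hasDerivAt_airyDeriv_sub l x).const_mul c).congr_deriv (by ring)
  rcases hl with h | h
  · obtain ⟨h1, h2⟩ := hasDerivAt_odd_solution hsolve hsolve' (by
      rw [osc] at h; simp [h])
    refine ⟨_, isEigenfunction_of_classical hl0.le h1 h2 ?_⟩
    have h0 : ∀ᵐ x : ℝ, x ≠ 0 := by simp [ae_iff]
    filter_upwards [h0] with x hx
    have hs : Real.sign x ^ 2 = 1 := by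
      rcases hx.lt_or_gt with h | h
      · rw [Real.sign_of_neg h]; norm_num
      · rw [Real.sign_of_pos h]; norm_num
    rw [mul_pow, mul_pow, hs, hc2, density]; ring
  · obtain ⟨h1, h2⟩ := hasDerivAt_even_solution hsolve hsolve' (by
      rw [oscDeriv, neg_eq_zero] at h; simp [h])
    refine ⟨_, isEigenfunction_of_classical hl0.le h1 h2 ?_⟩
    refine Eventually.of_forall fun x => ?_
    rw [mul_pow, hc2, density]; ring

/-! ### Classification of eigenvalues and eigenfunctions -/

theorem airy_wronskian (t : ℝ) :
    airy t * airySolDeriv 1 0 t - airyDeriv t * airySol 1 0 t = 1 := by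
  rw [airy, airyDeriv]
  linarith [airySol_wronskian t]

/-- Only multiples of `airy` are square integrable at infinity. -/
theorem eq_zero_of_memLp_combination {l : ℝ} {a b : ℂ}
    (h : MemLp (fun x : ℝ => a * (airy (x - l) : ℂ) + b * (airySol 1 0 (x - l) : ℂ)) 2
      (volume.restrict (Set.Ioi 0))) : b = 0 := by
  have h1 : MemLp (fun x : ℝ => (airy (x - l) : ℂ)) 2 (volume.restrict (Set.Ioi 0)) := by
    have hc : Continuous fun x : ℝ => (airy (x - l) : ℂ) :=
      Complex.continuous_ofReal.comp (continuous_airy.comp (continuous_id.sub continuous_const))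
    rw [memLp_two_iff_integrable_sq_norm hc.aestronglyMeasurable]
    refine (integrableOn_airy_sub_sq l 0).congr (Eventually.of_forall fun x => ?_)
    simp
  have h2 : MemLp (fun x : ℝ => b * (airySol 1 0 (x - l) : ℂ)) 2
      (volume.restrict (Set.Ioi 0)) := by
    convert h.sub (h1.const_mul a) using 1
    ext x
    simp
  have h3 : MemLp (fun _ : ℝ => b) 2 (volume.restrict (Set.Ioi (max 0 l))) := by
    refine (h2.mono_measure (Measure.restrict_mono (Set.Ioi_subset_Ioi (le_max_left 0 l))
      le_rfl)).mono aestronglyMeasurable_const ?_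
    filter_upwards [ae_restrict_mem measurableSet_Ioi] with x hx
    have hx' : l < x := (le_max_right 0 l).trans_lt hx
    have h4 := one_le_airySol (t := x - l) (by linarith)
    rw [norm_mul, Complex.norm_real, Real.norm_eq_abs, abs_of_nonneg (by linarith)]
    exact le_mul_of_one_le_right (norm_nonneg _) h4
  rw [memLp_const_iff (by norm_num) (by norm_num)] at h3
  rcases h3 with h3 | h3
  · exact h3
  · simp at h3

/-- Eigenvalues are zeros of `osc` or of its derivative, and the position density of a normalized
eigenfunction is determined by its eigenvalue. -/
theorem IsEigenfunction.mem_oscZeros_and_norm {l : ℝ} {u : ℝ → ℂ} (hu : IsEigenfunction l u) :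
    l ∈ oscZeros ∧ ∃ C : ℝ, ∀ᵐ x, ‖u x‖ ^ 2 = C * density l x := by
  set p := fun x => airy (x - l) with hp
  set p' := fun x => airyDeriv (x - l) with hp'
  set r := fun x => airySol 1 0 (x - l) with hr
  set r' := fun x => airySolDeriv 1 0 (x - l) with hr'
  have dp : ∀ x, HasDerivAt p (p' x) x := hasDerivAt_airy_sub l
  have dp' : ∀ x, HasDerivAt p' ((x - l) * p x) x := hasDerivAt_airyDeriv_sub l
  have dr : ∀ x, HasDerivAt r (r' x) x := fun x =>
    (hasDerivAt_airySol 1 0 (x - l)).comp_sub_const x l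
  have dr' : ∀ x, HasDerivAt r' ((x - l) * r x) x := fun x =>
    (hasDerivAt_airySolDeriv 1 0 (x - l)).comp_sub_const x l
  have hW : ∀ x, p x * r' x - p' x * r x = 1 := fun x => airy_wronskian (x - l)
  have comb : ∀ a b : ℝ, (∀ x, HasDerivAt (fun x => a * p x + b * r x) (a * p' x + b * r' x) x) ∧
      ∀ x, HasDerivAt (fun x => a * p' x + b * r' x) ((x - l) * (a * p x + b * r x)) x :=
    fun a b => ⟨fun x => ((dp x).const_mul a).add ((dr x).const_mul b), fun x =>
      (((dp' x).const_mul a).add ((dr' x).const_mul b)).congr_deriv (by ring)⟩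
  -- The coefficients make the derivative at 0, respectively the value at 0 for the odd solution
  -- below, vanish. Both half-line solutions exist for every l, and the Wronskian of their
  -- extensions at 0 is the square of that of p and r, hence 1.
  obtain ⟨e1, e2⟩ := hasDerivAt_even_solution (comb (r' 0) (-p' 0)).1 (comb (r' 0) (-p' 0)).2
    (by ring)
  obtain ⟨o1, o2⟩ := hasDerivAt_odd_solution (comb (-r 0) (p 0)).1 (comb (-r 0) (p 0)).2
    (by ring)
  have hWro := fun x => wronskian_eq (V := fun x => |x| - l) e1 e2 o1 o2 x 0
  obtain ⟨a, b, hab⟩ := hu.1.ae_eq_combination e1 e2 o1 o2 (fun x => by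
    rw [hWro x]
    simp only [abs_zero, Real.sign_zero]
    linear_combination (p 0 * r' 0 - p' 0 * r 0 + 1) * hW 0)
  have hpos : ∀ x : ℝ, 0 < x →
      a * ((r' 0 * p |x| + -p' 0 * r |x| : ℝ) : ℂ)
        + b * ((Real.sign x * (-r 0 * p |x| + p 0 * r |x|) : ℝ) : ℂ) =
      (a * r' 0 - b * r 0) * (p x : ℂ) + (-a * p' 0 + b * p 0) * (r x : ℂ) := fun x hx => by
    rw [Real.sign_of_pos hx, abs_of_pos hx]; push_cast; ring
  have hneg : ∀ x : ℝ, 0 < x →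
      a * ((r' 0 * p |-x| + -p' 0 * r |-x| : ℝ) : ℂ)
        + b * ((Real.sign (-x) * (-r 0 * p |-x| + p 0 * r |-x|) : ℝ) : ℂ) =
      (a * r' 0 + b * r 0) * (p x : ℂ) + (-a * p' 0 - b * p 0) * (r x : ℂ) := fun x hx => by
    rw [Real.sign_of_neg (neg_neg_of_pos hx), abs_neg, abs_of_pos hx]; push_cast; ring
  have hL := hu.1.1.ae_eq hab
  -- Square integrability at +∞ and at -∞ kills the coefficient of the non-decaying solution r on
  -- each side. The sum and difference of the two conditions give a p'(0) = 0 and b p(0) = 0, so a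
  -- nonzero u needs a zero of p or p' at 0.
  have h1 : -a * p' 0 + b * p 0 = 0 := by
    refine eq_zero_of_memLp_combination (l := l) (a := a * r' 0 - b * r 0) ?_
    refine (hL.mono_measure Measure.restrict_le_self).ae_eq ?_
    filter_upwards [ae_restrict_mem measurableSet_Ioi] with x hx using hpos x hx
  have h2 : -a * p' 0 - b * p 0 = 0 := by
    refine eq_zero_of_memLp_combination (l := l) (a := a * r' 0 + b * r 0) ?_
    refine ((hL.comp_measurePreserving (Measure.measurePreserving_neg volume)).mono_measure
      Measure.restrict_le_self).ae_eq ?_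
    filter_upwards [ae_restrict_mem measurableSet_Ioi] with x hx using hneg x hx
  have h3 : a * p' 0 = 0 := by linear_combination (-1 / 2) * (h1 + h2)
  have h4 : b * p 0 = 0 := by linear_combination (1 / 2) * (h1 - h2)
  have hpz : osc l = p 0 := by simp [osc, hp]
  have hpz' : oscDeriv l = -p' 0 := by simp [oscDeriv, hp']
  have hmem : l ∈ oscZeros := by
    by_contra hc
    simp only [oscZeros, Set.mem_ofPred_eq, not_or, hpz, hpz', neg_eq_zero] at hc
    have ha : a = 0 := by simpa [hc.2] using h3
    have hb : b = 0 := by simpa [hc.1] using h4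
    refine hu.2 (hab.trans (Eventually.of_forall fun x => ?_))
    simp [ha, hb]
  have hP := one_le_airyMass (oscZeros_pos hmem).le
  refine ⟨hmem, ?_⟩
  have hden : ∀ x, p |x| ^ 2 = 2 * airyMass l * density l x := fun x => by
    rw [density]; field_simp; rfl
  have h0 : ∀ᵐ x : ℝ, x ≠ 0 := by simp [ae_iff]
  by_cases hz : p 0 = 0
  · have hz' : p' 0 ≠ 0 := fun hz' => by simpa [hz, hz'] using hW 0
    have ha : a = 0 := by simpa [hz'] using h3
    refine ⟨‖b * (r 0 : ℂ)‖ ^ 2 * (2 * airyMass l), ?_⟩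
    filter_upwards [hab, h0] with x hx hx0
    have hs : ‖((Real.sign x : ℝ) : ℂ)‖ = 1 := by
      rcases hx0.lt_or_gt with h | h
      · rw [Real.sign_of_neg h]; simp
      · rw [Real.sign_of_pos h]; simp
    have : u x = -(b * r 0 * ((Real.sign x : ℝ) : ℂ) * (p |x| : ℝ)) := by
      rw [hx, ha, hz]; push_cast; ring
    rw [this, norm_neg, norm_mul, norm_mul, hs, mul_one, mul_pow, Complex.norm_real,
      Real.norm_eq_abs, sq_abs, hden]
    ring
  · have hb : b = 0 := by simpa [hz] using h4
    have hz' : p' 0 = 0 := by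
      rcases hmem with h | h
      · exact absurd (hpz ▸ h) hz
      · rw [hpz', neg_eq_zero] at h; exact h
    refine ⟨‖a * (r' 0 : ℂ)‖ ^ 2 * (2 * airyMass l), ?_⟩
    filter_upwards [hab] with x hx
    have : u x = a * r' 0 * (p |x| : ℝ) := by
      rw [hx, hb, hz']; push_cast; ring
    rw [this, norm_mul, mul_pow, Complex.norm_real, Real.norm_eq_abs, sq_abs, hden]
    ring

theorem isEigenvalue_iff {l : ℝ} : IsEigenvalue l ↔ l ∈ oscZeros :=
  ⟨fun ⟨_, hu⟩ => hu.mem_oscZeros_and_norm.1, fun h =>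
    let ⟨u, hu, _⟩ := exists_normalized_eigenfunction h
    ⟨u, hu⟩⟩

theorem IsEigenfunction.norm_sq_ae_eq_density {l : ℝ} {u : ℝ → ℂ} (hu : IsEigenfunction l u)
    (h1 : ∫ x, ‖u x‖ ^ 2 = 1) : (fun x => ‖u x‖ ^ 2) =ᵐ[volume] density l := by
  obtain ⟨hl, C, hC⟩ := hu.mem_oscZeros_and_norm
  have hP := one_le_airyMass (oscZeros_pos hl).le
  have h2 : ∫ x, density l x = 1 := by
    simp only [density]
    rw [integral_div, integral_airy_abs_sub_sq, div_self (by positivity)]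
  rw [integral_congr_ae hC, integral_const_mul, h2, mul_one] at h1
  filter_upwards [hC] with x hx
  rw [hx, h1, one_mul]

theorem exists_mem_oscZeros_Icc {s : ℝ} (hs : 1 ≤ s) : ∃ t ∈ oscZeros, t ∈ Set.Icc s (s + 4) :=
  let ⟨t, ht, h⟩ := exists_oscDeriv_eq_zero hs
  ⟨t, Or.inr h, ht⟩

/-! ### Enumeration of the spectrum -/

/-- A nonempty set of reals without maximum whose lower sections are finite is the range of a
strictly increasing sequence. -/
theorem exists_strictMono_range_eq {S : Set ℝ} (hfin : ∀ M, (S ∩ Set.Iic M).Finite)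
    (hub : ∀ M, ∃ s ∈ S, M < s) : ∃ f : ℕ → ℝ, StrictMono f ∧ Set.range f = S := by
  classical
  obtain ⟨s₀, hs₀, -⟩ := hub 0
  obtain ⟨b, hb, hmin⟩ := Set.exists_min_image _ id (hfin s₀) ⟨s₀, hs₀, le_refl s₀⟩
  have hbot : ∀ s : S, (⟨b, hb.1⟩ : S) ≤ s := fun s => by
    rcases le_total (s : ℝ) s₀ with h | h
    · exact hmin s ⟨s.2, h⟩
    · exact Subtype.coe_le_coe.1 (le_trans hb.2 h)
  let _ : LocallyFiniteOrder S := LocallyFiniteOrder.ofFiniteIcc fun x y => by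
    refine Set.Finite.of_finite_image ((hfin y).subset ?_) Subtype.val_injective.injOn
    rintro _ ⟨z, hz, rfl⟩
    exact ⟨z.2, hz.2⟩
  let _ : OrderBot S := { bot := ⟨b, hb.1⟩, bot_le := hbot }
  have : NoMaxOrder S := ⟨fun x =>
    let ⟨s, hs, h⟩ := hub x
    ⟨⟨s, hs⟩, h⟩⟩
  let _ : SuccOrder S := LinearLocallyFiniteOrder.succOrder S
  let _ : PredOrder S := LinearLocallyFiniteOrder.predOrder S
  let e : S ≃o ℕ := orderIsoNatOfLinearSuccPredArch
  refine ⟨fun n => e.symm n, fun m n h => e.symm.strictMono h, ?_⟩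
  ext s
  constructor
  · rintro ⟨n, rfl⟩
    exact (e.symm n).2
  · intro hs
    exact ⟨e ⟨s, hs⟩, by simp⟩

theorem exists_isEigensystem : ∃ (lam : ℕ → ℝ) (φ : ℕ → ℝ → ℂ), IsEigensystem lam φ := by
  obtain ⟨lam, hmono, hrange⟩ := exists_strictMono_range_eq finite_oscZeros_inter fun M => by
    obtain ⟨t, ht, h⟩ := exists_mem_oscZeros_Icc (le_max_left 1 (M + 1))
    exact ⟨t, ht, by linarith [h.1, le_max_right 1 (M + 1)]⟩
  choose φ hφ hφ1 using fun k =>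
    exists_normalized_eigenfunction (l := lam k) (hrange ▸ Set.mem_range_self k)
  refine ⟨lam, φ, hmono, ?_, hφ, hφ1⟩
  rw [hrange]
  ext l
  exact isEigenvalue_iff.symm

section Eigensystem

variable {lam : ℕ → ℝ} {φ : ℕ → ℝ → ℂ}

theorem IsEigensystem.range_eq_oscZeros (h : IsEigensystem lam φ) :
    Set.range lam = oscZeros := by
  rw [h.range_eq]
  ext l
  exact isEigenvalue_iff

theorem IsEigensystem.mem_oscZeros (h : IsEigensystem lam φ) (k : ℕ) : lam k ∈ oscZeros :=
  h.range_eq_oscZeros ▸ Set.mem_range_self k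

theorem IsEigensystem.exists_mem_Icc (h : IsEigensystem lam φ) {s : ℝ} (hs : 1 ≤ s) :
    ∃ k, lam k ∈ Set.Icc s (s + 4) := by
  obtain ⟨t, ht, hts⟩ := exists_mem_oscZeros_Icc hs
  rw [← h.range_eq_oscZeros] at ht
  obtain ⟨k, rfl⟩ := ht
  exact ⟨k, hts⟩

theorem IsEigensystem.tendsto_atTop (h : IsEigensystem lam φ) : Tendsto lam atTop atTop := by
  refine tendsto_atTop_atTop_of_monotone h.strictMono.monotone fun b => ?_
  obtain ⟨k, hk⟩ := h.exists_mem_Icc (le_max_left 1 b)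
  exact ⟨k, (le_max_right 1 b).trans hk.1⟩

theorem IsEigensystem.setIntegral_eq (h : IsEigensystem lam φ) (k : ℕ) (E : Set ℝ) :
    ∫ x in E, ‖φ k x‖ ^ 2 = ∫ x in E, density (lam k) x :=
  integral_congr_ae (ae_restrict_of_ae
    ((h.eigenfunction k).norm_sq_ae_eq_density (h.normalized k)))

end Eigensystem

/-! ### Weak thickness and the equivalence -/

theorem volume_inter_Icc_ne_top (E : Set ℝ) (x : ℝ) : volume (E ∩ Set.Icc (-x) x) ≠ ⊤ :=
  ne_top_of_le_ne_top isCompact_Icc.measure_lt_top.ne (measure_mono Set.inter_subset_right)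

theorem weaklyThick_iff {E : Set ℝ} : WeaklyThick E ↔
    ∃ γ : ℝ, 0 < γ ∧ ∀ᶠ x in atTop, γ * x ≤ volume.real (E ∩ Set.Icc (-x) x) := by
  constructor
  · intro h
    obtain ⟨c, hc0, hc⟩ := exists_between h
    have hct : c ≠ ⊤ := hc.ne_top
    refine ⟨c.toReal, ENNReal.toReal_pos hc0.ne' hct, ?_⟩
    filter_upwards [eventually_lt_of_lt_liminf hc, eventually_gt_atTop 0] with x hx hx0
    rw [ENNReal.lt_div_iff_mul_lt (Or.inl (by simpa using hx0)) (Or.inl ENNReal.ofReal_ne_top)]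
      at hx
    have := ENNReal.toReal_mono (volume_inter_Icc_ne_top E x) hx.le
    rwa [ENNReal.toReal_mul, ENNReal.toReal_ofReal hx0.le] at this
  · rintro ⟨γ, hγ, h⟩
    refine lt_of_lt_of_le (ENNReal.ofReal_pos.2 hγ) (le_liminf_of_le ?_ ?_)
    · isBoundedDefault
    filter_upwards [h, eventually_gt_atTop 0] with x hx hx0
    rw [ENNReal.le_div_iff_mul_le (Or.inl (by simpa using hx0)) (Or.inl ENNReal.ofReal_ne_top),
      ← ENNReal.ofReal_mul hγ.le]
    exact ENNReal.ofReal_le_of_le_toReal hx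

theorem IsEigensystem.exists_le_setIntegral_of_weaklyThick {lam : ℕ → ℝ} {φ : ℕ → ℝ → ℂ}
    (h : IsEigensystem lam φ) {E : Set ℝ} (hE : MeasurableSet E) (hthick : WeaklyThick E) :
    ∃ D : ℝ, 0 < D ∧ ∀ k, D ≤ ∫ x in E, ‖φ k x‖ ^ 2 := by
  obtain ⟨γ, hγ, hev⟩ := weaklyThick_iff.1 hthick
  have hE0 : volume E ≠ 0 := by
    intro h0
    obtain ⟨x, hx, hx0⟩ := (hev.and (eventually_gt_atTop 0)).exists
    have h1 : volume.real (E ∩ Set.Icc (-x) x) = 0 := by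
      rw [measureReal_def, measure_mono_null Set.inter_subset_left h0, ENNReal.toReal_zero]
    rw [h1] at hx
    exact absurd hx (not_le.2 (by positivity))
  obtain ⟨D, hD, X, hX⟩ := le_setIntegral_density hγ
  obtain ⟨N, hN⟩ := eventually_atTop.1
    (h.tendsto_atTop.eventually (hev.and (eventually_ge_atTop X)))
  have hpos : ∀ k, 0 < ∫ x in E, ‖φ k x‖ ^ 2 := fun k => by
    rw [h.setIntegral_eq]
    exact setIntegral_density_pos (oscZeros_pos (h.mem_oscZeros k)).le hE0
  -- The uniform bound holds only from index N on; the smallest of the first N + 1 integrals is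
  -- positive and covers the others.
  obtain ⟨j, -, hj⟩ := Finset.exists_min_image (Finset.range (N + 1))
    (fun k => ∫ x in E, ‖φ k x‖ ^ 2) ⟨0, by simp⟩
  refine ⟨min D (∫ x in E, ‖φ j x‖ ^ 2), lt_min hD (hpos j), fun k => ?_⟩
  rcases le_total N k with hk | hk
  · refine (min_le_left _ _).trans ?_
    rw [h.setIntegral_eq]
    exact hX _ (hN k hk).2 E hE (hN k hk).1
  · exact (min_le_right _ _).trans (hj k (Finset.mem_range.2 (by omega)))

theorem IsEigensystem.weaklyThick_of_le_setIntegral {lam : ℕ → ℝ} {φ : ℕ → ℝ → ℂ}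
    (h : IsEigensystem lam φ) {E : Set ℝ} (hE : MeasurableSet E) {D : ℝ} (hD : 0 < D)
    (hDE : ∀ k, D ≤ ∫ x in E, ‖φ k x‖ ^ 2) : WeaklyThick E := by
  obtain ⟨η, hη, X, hX⟩ := volume_ge_of_le_setIntegral_density hD
  refine weaklyThick_iff.2 ⟨η / 2, by positivity, ?_⟩
  -- Some eigenvalue lies in [x - 4, x]. For x ≥ 8 it is at least x/2, which accounts for the loss
  -- from η to η/2.
  filter_upwards [eventually_ge_atTop (X + 4), eventually_ge_atTop 8] with x hxX hx8
  obtain ⟨k, hk1, hk2⟩ := h.exists_mem_Icc (s := x - 4) (by linarith)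
  have h1 := hX (lam k) (by linarith) E hE (h.setIntegral_eq k E ▸ hDE k)
  have h2 : volume.real (E ∩ Set.Icc (-lam k) (lam k)) ≤ volume.real (E ∩ Set.Icc (-x) x) :=
    measureReal_mono (Set.inter_subset_inter_right _
      (Set.Icc_subset_Icc (by linarith) (by linarith))) (volume_inter_Icc_ne_top E x)
  refine le_trans ?_ (h1.trans h2)
  nlinarith

end AnharmonicOscillator

/-- The eigenvalues of `H = -d²/dx² + |x|` form an increasing sequence `λ_1 < λ_2 < ⋯`, and for
every choice of normalized eigenfunctions `φ_k` a Lebesgue measurable set `E` is weakly thick if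
and only if `∫_E |φ_k|²` is bounded below by a positive constant independent of `k`. -/
theorem lemma3p1 (E : Set ℝ) (hE : NullMeasurableSet E volume) :
    (∃ (lam : ℕ → ℝ) (φ : ℕ → ℝ → ℂ), AnharmonicOscillator.IsEigensystem lam φ) ∧
    ∀ (lam : ℕ → ℝ) (φ : ℕ → ℝ → ℂ), AnharmonicOscillator.IsEigensystem lam φ →
      (AnharmonicOscillator.WeaklyThick E ↔
        ∃ D : ℝ, 0 < D ∧ ∀ k : ℕ, D ≤ ∫ x in E, ‖φ k x‖ ^ 2) := by
  refine ⟨AnharmonicOscillator.exists_isEigensystem, fun lam φ h => ?_⟩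
  -- Lebesgue measurability is null measurability for `volume`. Both sides of the equivalence ignore
  -- null sets, so a Borel representative may replace E.
  obtain ⟨F, hF, hEF⟩ : ∃ F, MeasurableSet F ∧ E =ᵐ[volume] F :=
    ⟨toMeasurable volume E, measurableSet_toMeasurable _ _, hE.toMeasurable_ae_eq.symm⟩
  have hthick : AnharmonicOscillator.WeaklyThick E ↔ AnharmonicOscillator.WeaklyThick F := by
    have hx : ∀ x : ℝ, volume (E ∩ Set.Icc (-x) x) = volume (F ∩ Set.Icc (-x) x) := fun x =>
      measure_congr (hEF.inter (ae_eq_refl _))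
    simp only [AnharmonicOscillator.WeaklyThick, hx]
  rw [hthick, Measure.restrict_congr_set hEF]
  exact ⟨h.exists_le_setIntegral_of_weaklyThick hF, fun ⟨D, hD, hDE⟩ =>
    h.weaklyThick_of_le_setIntegral hF hD hDE⟩
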